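/- Let $R$ be a commutative ring. A divided power (DP) $R$-algebra is a commutative non-unital $R$-algebra $A$ with maps $\gamma_n : A \to A$ ($n \ge 1$) such that, for $a, b \in A$ and $r \in R$, $\gamma_1(a) = a$, $\gamma_n(a+b) = \gamma_n(a) + \sum_{i+j=n,\ i,j\ge 1}\gamma_i(a)\gamma_j(b) + \gamma_n(b)$, $\gamma_n(ab) = a^n\gamma_n(b)$, $\gamma_n(rb) = r^n\gamma_n(b)$, $\gamma_m(a)\gamma_n(a) = \frac{(m+n)!}{m!\,n!}\gamma_{m+n}(a)$ and $\gamma_m(\gamma_n(a)) = \frac{(mn)!}{m!\,(n!)^m}\gamma_{mn}(a)$. Let $A_+ = A \oplus R$ be the unitization of $A$, let $\Omega^{CA}_{A/R} = \Omega_{A_+/R}$ be the usual module of Kähler differentials, and let $d : A \to \Omega^{CA}_{A/R}$ be the restriction to $A$ of the universal $R$-derivation of $A_+$. Let $U(0)$ be the associative unital ring $R[\phi_p : p \text{ prime}]/(p\phi_p)$ with the twisted product $\phi_p r = r^p\phi_p$ for $r \in R$; write $\phi_{p^e} = \phi_p^e$ for $e \ge 0$, and $\phi_n = 0$ if $n$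 is not a power of a prime. Let $U(A) = A_+ \otimes_R U(0)$ be the associative unital ring in which $A_+$ and $U(0)$ are subrings via $x \mapsto x \otimes 1$ and $u \mapsto 1 \otimes u$, $(x\otimes 1)(1 \otimes u) = x \otimes u$, and $(1\otimes\phi_p)(a\otimes 1) = 0$ for $a \in A$ and $p$ prime. It is a left $A_+$-module and a right $R$-module by left and right multiplication. **Corollary (Roby).** Let $V$ be an $R$-module, and let $A = \Gamma_R(V)$ be the free DP $R$-algebra generated by $V$ (the value at $V$ of the left adjoint of the forgetful functor from DP $R$-algebras to $R$-modules). Then there is an isomorphism of $A_+$-modules $$e : \Omega^{CA}_{A/R} \xrightarrow{\ \cong\ } U(A)\otimes_R V,$$ where $U(A) \otimes_R V$ is formed with the right $R$-module structure of $U(A)$. Moreover $e$ may be chosen so that $e(dv) = 1 \otimes v$ for all $v \in V$ and $$e(d\gamma_n(a)) = \phi_n\, e(da) + \sum_{i+j=n,\ i,j\ge 1}\gamma_i(a)\,\phi_j\, e(da)\qquad (a \in A,\ n \ge 1).$$ -/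

import Mathlib

open scoped TensorProduct

universe u v w

/-! ### Divided power algebras

Throughout, an "algebra" over the commutative ring `R` is a commutative non-unital `R`-algebra:
`[NonUnitalCommRing A] [Module R A] [IsScalarTower R A A] [SMulCommClass R A A]`.
Its unitization `A₊ = A ⊕ R` is `Unitization R A`. -/

/-- A divided power structure on the non-unital commutative `R`-algebra `A`: operations
`γ n : A → A` for `n > 0`.  For convenience the index runs over all of `ℕ`, and the meaningless
operation of index `0` is normalised to be zero.
The expression `(fun x => a * x)^[n] y` is `a ^ n * y`, and `Nat.uniformBell m n` is
`(m * n)! / (m! * (n!) ^ m)`. -/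
class DPAlgebra (R : Type u) (A : Type w) [CommRing R] [NonUnitalCommRing A] [Module R A] where
  γ : ℕ → A → A
  γ_zero : ∀ a, γ 0 a = 0
  γ_one : ∀ a, γ 1 a = a
  γ_add : ∀ n, 0 < n → ∀ a b,
    γ n (a + b) = γ n a + ∑ i ∈ Finset.Ioo 0 n, γ i a * γ (n - i) b + γ n b
  γ_mul : ∀ n, 0 < n → ∀ a b, γ n (a * b) = (fun x => a * x)^[n] (γ n b)
  γ_smul : ∀ n, 0 < n → ∀ (r : R) (b : A), γ n (r • b) = r ^ n • γ n b
  mul_γ : ∀ m n, 0 < m → 0 < n → ∀ a, γ m a * γ n a = (m + n).choose m • γ (m + n) a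
  γ_γ : ∀ m n, 0 < m → 0 < n → ∀ a, γ m (γ n a) = m.uniformBell n • γ (m * n) a

/-! ### The free divided power algebra on a module -/

/-- Formal expressions in the operations of a divided power `R`-algebra and elements of `V`. -/
inductive FreeDP.Term (R : Type u) (V : Type v) : Type (max u v)
  | of (x : V)
  | zero
  | add (s t : FreeDP.Term R V)
  | neg (t : FreeDP.Term R V)
  | smul (r : R) (t : FreeDP.Term R V)
  | mul (s t : FreeDP.Term R V)
  | γ (n : ℕ) (t : FreeDP.Term R V)

/-- The formal expression `∑_{0 < i ≤ k} γ i s * γ (n - i) t`. -/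
def FreeDP.Term.partialSum {R : Type u} {V : Type v} (n : ℕ) (s t : FreeDP.Term R V) :
    ℕ → FreeDP.Term R V
  | 0 => zero
  | k + 1 => (partialSum n s t k).add ((γ (k + 1) s).mul (γ (n - (k + 1)) t))

/-- The smallest congruence on formal expressions that forces the axioms of a divided power
`R`-algebra and the `R`-linearity of the inclusion of `V`. -/
inductive FreeDP.Rel (R : Type u) (V : Type v) [CommRing R] [AddCommGroup V] [Module R V] :
    FreeDP.Term R V → FreeDP.Term R V → Prop
  -- equivalence relation
  | refl (a : Term R V) : Rel R V a a
  | symm {a b : Term R V} : Rel R V a b → Rel R V b a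
  | trans {a b c : Term R V} : Rel R V a b → Rel R V b c → Rel R V a c
  -- compatibility with the operations
  | add_congr {a a' b b' : Term R V} : Rel R V a a' → Rel R V b b' → Rel R V (a.add b) (a'.add b')
  | neg_congr {a a' : Term R V} : Rel R V a a' → Rel R V a.neg a'.neg
  | smul_congr (r : R) {a a' : Term R V} : Rel R V a a' → Rel R V (a.smul r) (a'.smul r)
  | mul_congr {a a' b b' : Term R V} : Rel R V a a' → Rel R V b b' → Rel R V (a.mul b) (a'.mul b')
  | γ_congr (n : ℕ) {a a' : Term R V} : Rel R V a a' → Rel R V (a.γ n) (a'.γ n)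
  -- `R`-module axioms
  | add_assoc (a b c : Term R V) : Rel R V ((a.add b).add c) (a.add (b.add c))
  | add_comm (a b : Term R V) : Rel R V (a.add b) (b.add a)
  | zero_add (a : Term R V) : Rel R V (Term.zero.add a) a
  | neg_add (a : Term R V) : Rel R V (a.neg.add a) .zero
  | one_smul (a : Term R V) : Rel R V (a.smul 1) a
  | mul_smul (r s : R) (a : Term R V) : Rel R V (a.smul (r * s)) ((a.smul s).smul r)
  | smul_add (r : R) (a b : Term R V) : Rel R V ((a.add b).smul r) ((a.smul r).add (b.smul r))
  | add_smul (r s : R) (a : Term R V) : Rel R V (a.smul (r + s)) ((a.smul r).add (a.smul s))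
  -- commutative algebra axioms
  | mul_assoc (a b c : Term R V) : Rel R V ((a.mul b).mul c) (a.mul (b.mul c))
  | mul_comm (a b : Term R V) : Rel R V (a.mul b) (b.mul a)
  | add_mul (a b c : Term R V) : Rel R V ((a.add b).mul c) ((a.mul c).add (b.mul c))
  | smul_mul (r : R) (a b : Term R V) : Rel R V ((a.smul r).mul b) ((a.mul b).smul r)
  -- linearity of the inclusion of `V`
  | of_add (x y : V) : Rel R V (.of (x + y)) ((Term.of x).add (.of y))
  | of_smul (r : R) (x : V) : Rel R V (.of (r • x)) ((Term.of x).smul r)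
  -- divided power axioms
  | γ_zero (a : Term R V) : Rel R V (a.γ 0) .zero
  | γ_one (a : Term R V) : Rel R V (a.γ 1) a
  | γ_add (n : ℕ) (hn : 0 < n) (a b : Term R V) :
      Rel R V ((a.add b).γ n) (((a.γ n).add (a.partialSum n b (n - 1))).add (b.γ n))
  | γ_mul (n : ℕ) (hn : 0 < n) (a b : Term R V) :
      Rel R V ((a.mul b).γ n) ((fun t => a.mul t)^[n] (b.γ n))
  | γ_smul (n : ℕ) (hn : 0 < n) (r : R) (b : Term R V) :
      Rel R V ((b.smul r).γ n) ((b.γ n).smul (r ^ n))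
  | mul_γ (m n : ℕ) (hm : 0 < m) (hn : 0 < n) (a : Term R V) :
      Rel R V ((a.γ m).mul (a.γ n)) ((a.γ (m + n)).smul ((m + n).choose m : R))
  | γ_γ (m n : ℕ) (hm : 0 < m) (hn : 0 < n) (a : Term R V) :
      Rel R V ((a.γ n).γ m) ((a.γ (m * n)).smul (m.uniformBell n : R))

/-- The setoid of the congruence `FreeDP.Rel`. -/
def FreeDP.setoid (R : Type u) (V : Type v) [CommRing R] [AddCommGroup V] [Module R V] :
    Setoid (FreeDP.Term R V) :=
  ⟨FreeDP.Rel R V, .refl, .symm, .trans⟩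

/-- The free divided power algebra `Γ_R(V)` on the `R`-module `V`. -/
def FreeDP (R : Type u) (V : Type v) [CommRing R] [AddCommGroup V] [Module R V] :
    Type (max u v) :=
  Quotient (FreeDP.setoid R V)

namespace FreeDP

section

variable {R : Type u} {V : Type v} [CommRing R] [AddCommGroup V] [Module R V]

/-- The class of a formal expression. -/
def mk (t : Term R V) : FreeDP R V := Quotient.mk (setoid R V) t

theorem sound {s t : Term R V} (h : Rel R V s t) : mk s = mk t := Quotient.sound h

@[elab_as_elim]
theorem ind {P : FreeDP R V → Prop} (h : ∀ t, P (mk t)) (x : FreeDP R V) : P x :=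
  Quotient.ind h x

instance : Zero (FreeDP R V) := ⟨mk .zero⟩
instance : Add (FreeDP R V) := ⟨Quotient.map₂ Term.add fun _ _ h _ _ h' => .add_congr h h'⟩
instance : Neg (FreeDP R V) := ⟨Quotient.map Term.neg fun _ _ h => .neg_congr h⟩
instance : SMul R (FreeDP R V) := ⟨fun r => Quotient.map (Term.smul r) fun _ _ h => .smul_congr r h⟩
instance : Mul (FreeDP R V) := ⟨Quotient.map₂ Term.mul fun _ _ h _ _ h' => .mul_congr h h'⟩

theorem mk_zero : mk (.zero : Term R V) = 0 := rfl
theorem mk_add (s t : Term R V) : mk (s.add t) = mk s + mk t := rfl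
theorem mk_neg (t : Term R V) : mk t.neg = -mk t := rfl
theorem mk_smul (r : R) (t : Term R V) : mk (t.smul r) = r • mk t := rfl
theorem mk_mul (s t : Term R V) : mk (s.mul t) = mk s * mk t := rfl

instance : AddCommGroup (FreeDP R V) :=
  { AddGroup.ofLeftAxioms
      (fun a b c => ind (fun a => ind (fun b => ind (fun c => sound (.add_assoc a b c)) c) b) a)
      (fun a => ind (fun a => sound (.zero_add a)) a)
      (fun a => ind (fun a => sound (.neg_add a)) a) with
    add_comm := fun a b => ind (fun a => ind (fun b => sound (.add_comm a b)) b) a }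

theorem mul_comm' (a b : FreeDP R V) : a * b = b * a :=
  ind (fun a => ind (fun b => sound (.mul_comm a b)) b) a

theorem add_mul' (a b c : FreeDP R V) : (a + b) * c = a * c + b * c :=
  ind (fun a => ind (fun b => ind (fun c => sound (.add_mul a b c)) c) b) a

theorem zero_mul' (a : FreeDP R V) : 0 * a = 0 := by
  have h := add_mul' 0 0 a
  rw [add_zero] at h
  exact left_eq_add.mp h

instance : NonUnitalCommRing (FreeDP R V) :=
  { (inferInstance : AddCommGroup (FreeDP R V)) with
    mul_assoc := fun a b c =>
      ind (fun a => ind (fun b => ind (fun c => sound (.mul_assoc a b c)) c) b) a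
    mul_comm := mul_comm'
    right_distrib := add_mul'
    left_distrib := fun a b c => by
      rw [mul_comm' a, add_mul', mul_comm' b, mul_comm' c]
    zero_mul := zero_mul'
    mul_zero := fun a => by rw [mul_comm', zero_mul'] }

theorem smul_add' (r : R) (a b : FreeDP R V) : r • (a + b) = r • a + r • b :=
  ind (fun a => ind (fun b => sound (.smul_add r a b)) b) a

theorem add_smul' (r s : R) (a : FreeDP R V) : (r + s) • a = r • a + s • a :=
  ind (fun a => sound (.add_smul r s a)) a

instance : Module R (FreeDP R V) where
  one_smul a := ind (fun a => sound (.one_smul a)) a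
  mul_smul r s a := ind (fun a => sound (.mul_smul r s a)) a
  smul_add := smul_add'
  smul_zero r := by
    have h := smul_add' (V := V) r 0 0
    rw [add_zero] at h
    exact left_eq_add.mp h
  add_smul := add_smul'
  zero_smul a := by
    have h := add_smul' (0 : R) 0 a
    rw [add_zero] at h
    exact left_eq_add.mp h

instance : IsScalarTower R (FreeDP R V) (FreeDP R V) :=
  ⟨fun r a b => ind (fun a => ind (fun b => sound (.smul_mul r a b)) b) a⟩

instance : SMulCommClass R (FreeDP R V) (FreeDP R V) :=
  ⟨fun r a b => by
    rw [smul_eq_mul, smul_eq_mul, mul_comm' a b, mul_comm' a]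
    exact (smul_mul_assoc r b a).symm⟩

/-- The divided power operations of the free divided power algebra. -/
def dpow (n : ℕ) : FreeDP R V → FreeDP R V :=
  Quotient.map (Term.γ n) fun _ _ h => .γ_congr n h

theorem mk_γ (n : ℕ) (t : Term R V) : mk (t.γ n) = dpow n (mk t) := rfl

theorem sum_Ioo_eq_sum_range {B : Type w} [AddCommMonoid B] (f : ℕ → B) (n : ℕ) :
    ∑ i ∈ Finset.Ioo 0 n, f i = ∑ k ∈ Finset.range (n - 1), f (k + 1) := by
  have h : Finset.Ioo 0 n = (Finset.range (n - 1)).image (· + 1) := by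
    ext i
    simp only [Finset.mem_Ioo, Finset.mem_image, Finset.mem_range]
    constructor
    · rintro ⟨h1, h2⟩
      exact ⟨i - 1, by omega, by omega⟩
    · rintro ⟨k, hk, rfl⟩
      omega
  rw [h, Finset.sum_image (fun _ _ _ _ h => Nat.succ_injective h)]

theorem mk_partialSum (n : ℕ) (s t : Term R V) (k : ℕ) :
    mk (s.partialSum n t k)
      = ∑ i ∈ Finset.range k, dpow (i + 1) (mk s) * dpow (n - (i + 1)) (mk t) := by
  induction k with
  | zero => rfl
  | succ k ih =>
    rw [Finset.sum_range_succ, ← ih]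
    rfl

theorem mk_iterate_mul (s t : Term R V) (n : ℕ) :
    mk ((fun x => s.mul x)^[n] t) = (fun x => mk s * x)^[n] (mk t) := by
  induction n with
  | zero => rfl
  | succ n ih => rw [Function.iterate_succ_apply', Function.iterate_succ_apply', ← ih, mk_mul]

/-- The divided power structure of the free divided power algebra. -/
instance : DPAlgebra R (FreeDP R V) where
  γ := dpow
  γ_zero a := ind (fun a => sound (.γ_zero a)) a
  γ_one a := ind (fun a => sound (.γ_one a)) a
  γ_add n hn a b := by
    refine ind (fun s => ind (fun t => ?_) b) a
    rw [sum_Ioo_eq_sum_range, ← mk_partialSum]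
    exact sound (.γ_add n hn s t)
  γ_mul n hn a b := by
    refine ind (fun s => ind (fun t => ?_) b) a
    rw [← mk_γ, ← mk_iterate_mul]
    exact sound (.γ_mul n hn s t)
  γ_smul n hn r b := ind (fun b => sound (.γ_smul n hn r b)) b
  mul_γ m n hm hn a := by
    rw [← Nat.cast_smul_eq_nsmul R]
    exact ind (fun a => sound (.mul_γ m n hm hn a)) a
  γ_γ m n hm hn a := by
    rw [← Nat.cast_smul_eq_nsmul R]
    exact ind (fun a => sound (.γ_γ m n hm hn a)) a

variable (R V) in
/-- The inclusion of the generators `V → Γ_R(V)`. -/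
def ι : V →ₗ[R] FreeDP R V where
  toFun x := mk (.of x)
  map_add' x y := sound (.of_add x y)
  map_smul' r x := sound (.of_smul r x)

section lift

variable {B : Type w} [NonUnitalCommRing B] [Module R B] [DPAlgebra R B]

set_option linter.unusedSectionVars false

/-- Evaluation of formal expressions in a divided power algebra. -/
def interp (f : V → B) : Term R V → B
  | .of x => f x
  | .zero => 0
  | .add s t => interp f s + interp f t
  | .neg t => -interp f t
  | .smul r t => r • interp f t
  | .mul s t => interp f s * interp f t
  | .γ n t => DPAlgebra.γ R n (interp f t)

theorem interp_partialSum (f : V → B) (n : ℕ) (s t : Term R V) (k : ℕ) :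
    interp f (s.partialSum n t k) = ∑ i ∈ Finset.range k,
      DPAlgebra.γ R (i + 1) (interp f s) * DPAlgebra.γ R (n - (i + 1)) (interp f t) := by
  induction k with
  | zero => rfl
  | succ k ih =>
    rw [Finset.sum_range_succ, ← ih]
    rfl

theorem interp_iterate_mul (f : V → B) (s t : Term R V) (n : ℕ) :
    interp f ((fun x => s.mul x)^[n] t) = (fun x => interp f s * x)^[n] (interp f t) := by
  induction n with
  | zero => rfl
  | succ n ih =>
    rw [Function.iterate_succ_apply', Function.iterate_succ_apply', ← ih]
    rfl

variable [IsScalarTower R B B]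

theorem interp_eq (f : V →ₗ[R] B) {s t : Term R V} (h : Rel R V s t) :
    interp f s = interp f t := by
  induction h with
  | refl => rfl
  | symm _ ih => exact ih.symm
  | trans _ _ ih ih' => exact ih.trans ih'
  | add_congr _ _ ih ih' => simp only [interp, ih, ih']
  | neg_congr _ ih => simp only [interp, ih]
  | smul_congr r _ ih => simp only [interp, ih]
  | mul_congr _ _ ih ih' => simp only [interp, ih, ih']
  | γ_congr n _ ih => simp only [interp, ih]
  | add_assoc => exact _root_.add_assoc _ _ _
  | add_comm => exact _root_.add_comm _ _
  | zero_add => exact _root_.zero_add _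
  | neg_add => exact neg_add_cancel _
  | one_smul => exact _root_.one_smul _ _
  | mul_smul => exact SemigroupAction.mul_smul _ _ _
  | smul_add => exact _root_.smul_add _ _ _
  | add_smul => exact _root_.add_smul _ _ _
  | mul_assoc => exact _root_.mul_assoc _ _ _
  | mul_comm => exact _root_.mul_comm _ _
  | add_mul => exact _root_.add_mul _ _ _
  | smul_mul => exact smul_mul_assoc _ _ _
  | of_add => exact map_add f _ _
  | of_smul => exact map_smul f _ _
  | γ_zero => exact DPAlgebra.γ_zero _
  | γ_one => exact DPAlgebra.γ_one _
  | γ_add n hn a b =>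
    have h := DPAlgebra.γ_add (R := R) n hn (interp f a) (interp f b)
    rw [sum_Ioo_eq_sum_range, ← interp_partialSum] at h
    exact h
  | γ_mul n hn a b =>
    rw [interp_iterate_mul]
    exact DPAlgebra.γ_mul n hn _ _
  | γ_smul n hn r b => exact DPAlgebra.γ_smul n hn r _
  | mul_γ m n hm hn a =>
    have h := DPAlgebra.mul_γ (R := R) m n hm hn (interp f a)
    rw [← Nat.cast_smul_eq_nsmul R] at h
    exact h
  | γ_γ m n hm hn a =>
    have h := DPAlgebra.γ_γ (R := R) m n hm hn (interp f a)
    rw [← Nat.cast_smul_eq_nsmul R] at h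
    exact h

/-- The universal property of `Γ_R(V)`: every `R`-linear map from `V` to a divided power algebra
extends uniquely to a morphism of divided power algebras, i.e. an algebra map commuting with the
divided power operations. -/
theorem existsUnique_lift (f : V →ₗ[R] B) :
    ∃! g : FreeDP R V →ₙₐ[R] B,
      (∀ n a, g (DPAlgebra.γ R n a) = DPAlgebra.γ R n (g a)) ∧ ∀ x, g (ι R V x) = f x := by
  refine ⟨{ toFun := Quotient.lift (interp f) fun _ _ h => interp_eq f h
            map_smul' := fun r a => ind (fun _ => rfl) a
            map_zero' := rfl
            map_add' := fun a b => ind (fun _ => ind (fun _ => rfl) b) a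
            map_mul' := fun a b => ind (fun _ => ind (fun _ => rfl) b) a },
    ⟨fun n a => ind (fun _ => rfl) a, fun x => rfl⟩, ?_⟩
  rintro g ⟨hγ, hι⟩
  ext a
  refine ind (fun t => ?_) a
  change g (mk t) = interp f t
  induction t with
  | of x => exact hι x
  | zero => exact map_zero g
  | add s t hs ht => rw [mk_add, map_add, hs, ht, interp]
  | neg t ht => rw [mk_neg, map_neg, ht, interp]
  | smul r t ht => rw [mk_smul, map_smul, ht, interp]
  | mul s t hs ht => rw [mk_mul, map_mul, hs, ht, interp]
  | γ n t ht => rw [interp, ← ht, ← hγ]; rfl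

end lift

end

end FreeDP

/-! ### The ring `U(0)` -/

/-- The relations defining `U(0)` on the generators `r ∈ R` and `φ_p`, `p` prime: the map from `R`
is a ring homomorphism, `p φ_p = 0`, and `φ_p r = r ^ p φ_p`. -/
inductive U0.Rel (R : Type u) [CommRing R] :
    FreeAlgebra ℤ (R ⊕ Nat.Primes) → FreeAlgebra ℤ (R ⊕ Nat.Primes) → Prop
  | one : Rel R (FreeAlgebra.ι ℤ (.inl 1)) 1
  | add (r s : R) : Rel R (FreeAlgebra.ι ℤ (.inl (r + s)))
      (FreeAlgebra.ι ℤ (.inl r) + FreeAlgebra.ι ℤ (.inl s))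
  | mul (r s : R) : Rel R (FreeAlgebra.ι ℤ (.inl (r * s)))
      (FreeAlgebra.ι ℤ (.inl r) * FreeAlgebra.ι ℤ (.inl s))
  | torsion (p : Nat.Primes) : Rel R ((p : ℕ) • FreeAlgebra.ι ℤ (.inr p)) 0
  | twist (p : Nat.Primes) (r : R) :
      Rel R (FreeAlgebra.ι ℤ (.inr p) * FreeAlgebra.ι ℤ (.inl r))
        (FreeAlgebra.ι ℤ (.inl (r ^ (p : ℕ))) * FreeAlgebra.ι ℤ (.inr p))

/-- The associative unital ring `U(0) = R[φ_p : p prime]/(p φ_p)` with the twisted product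
`φ_p r = r ^ p φ_p`. -/
def U0 (R : Type u) [CommRing R] : Type u := RingQuot (U0.Rel R)

namespace U0

variable (R : Type u) [CommRing R]

noncomputable instance : Ring (U0 R) := inferInstanceAs (Ring (RingQuot (U0.Rel R)))

/-- The quotient map from the free ring on the generators. -/
noncomputable def mk : FreeAlgebra ℤ (R ⊕ Nat.Primes) →+* U0 R := RingQuot.mkRingHom (Rel R)

variable {R} in
theorem mk_rel {x y : FreeAlgebra ℤ (R ⊕ Nat.Primes)} (h : Rel R x y) : mk R x = mk R y :=
  RingQuot.mkRingHom_rel h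

/-- The (not necessarily central) ring homomorphism `R → U(0)`. -/
noncomputable def coeff : R →+* U0 R :=
  RingHom.mk' ⟨⟨fun r => mk R (FreeAlgebra.ι ℤ (.inl r)), (mk_rel .one).trans (map_one _)⟩,
    fun r s => (mk_rel (.mul r s)).trans (map_mul _ _ _)⟩
    fun r s => (mk_rel (.add r s)).trans (map_add _ _ _)

/-- The generator `φ_p`, for a prime number `p`. -/
noncomputable def φ (p : Nat.Primes) : U0 R := mk R (FreeAlgebra.ι ℤ (.inr p))

/-- The convention `φ_{p ^ e} = φ_p ^ e` for `p` prime and `e ≥ 0` (so that `φ_1 = 1`), and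
`φ_n = 0` if `n` is not a power of a prime. -/
noncomputable def phi (n : ℕ) : U0 R :=
  if n = 1 then 1
  else if h : IsPrimePow n then
    φ R ⟨n.minFac, Nat.minFac_prime h.ne_one⟩ ^ n.factorization n.minFac
  else 0

theorem phi_prime_pow (p : Nat.Primes) (e : ℕ) : phi R ((p : ℕ) ^ e) = φ R p ^ e := by
  rcases Nat.eq_zero_or_pos e with rfl | he
  · simp [phi]
  · have hne : (p : ℕ) ^ e ≠ 1 := (Nat.one_lt_pow he.ne' p.2.one_lt).ne'
    have hpp : IsPrimePow ((p : ℕ) ^ e) := p.2.isPrimePow.pow he.ne'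
    have hm : ((p : ℕ) ^ e).minFac = p := p.2.pow_minFac he.ne'
    have hp : (⟨((p : ℕ) ^ e).minFac, Nat.minFac_prime hpp.ne_one⟩ : Nat.Primes) = p :=
      Subtype.ext hm
    rw [phi, if_neg hne, dif_pos hpp, hp, hm, p.2.factorization_pow, Finsupp.single_eq_same]

/-- The augmentation `U(0) → R`, which sends every `φ_p` to zero. -/
noncomputable def aug : U0 R →+* R :=
  RingQuot.lift ⟨(FreeAlgebra.lift ℤ (Sum.elim id fun _ => 0) :
      FreeAlgebra ℤ (R ⊕ Nat.Primes) →ₐ[ℤ] R).toRingHom, by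
    intro x y h
    induction h <;> simp⟩

theorem aug_coeff (r : R) : aug R (coeff R r) = r := by
  change RingQuot.lift _ (RingQuot.mkRingHom _ _) = r
  rw [RingQuot.lift_mkRingHom_apply]
  simp

theorem aug_φ (p : Nat.Primes) : aug R (φ R p) = 0 := by
  change RingQuot.lift _ (RingQuot.mkRingHom _ _) = 0
  rw [RingQuot.lift_mkRingHom_apply]
  simp

/-- `U(0)` as a left `R`-module. -/
noncomputable instance : Module R (U0 R) := Module.compHom (U0 R) (coeff R)

theorem smul_def (r : R) (x : U0 R) : r • x = coeff R r * x := rfl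

end U0

/-! ### The universal enveloping algebra `U(A)` -/

/-- The universal enveloping algebra `U(A) = A₊ ⊗_R U(0)`; here the left `R`-module structure of
`U(0)` is used. -/
def UEnv (R : Type u) (A : Type w) [CommRing R] [NonUnitalCommRing A] [Module R A]
    [IsScalarTower R A A] [SMulCommClass R A A] : Type (max u w) :=
  Unitization R A ⊗[R] U0 R

namespace UEnv

variable (R : Type u) (A : Type w) [CommRing R] [NonUnitalCommRing A] [Module R A]
  [IsScalarTower R A A] [SMulCommClass R A A]

noncomputable instance : AddCommGroup (UEnv R A) :=
  inferInstanceAs (AddCommGroup (Unitization R A ⊗[R] U0 R))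

/-- The left `A₊`-module structure `x • (y ⊗ u) = x y ⊗ u` on `U(A)`. -/
noncomputable instance : Module (Unitization R A) (UEnv R A) :=
  inferInstanceAs (Module (Unitization R A) (Unitization R A ⊗[R] U0 R))

/-- The element `x ⊗ u` of `U(A)`. -/
noncomputable def tmul (x : Unitization R A) (u : U0 R) : UEnv R A := x ⊗ₜ[R] u

variable {R A}

theorem smul_tmul (x y : Unitization R A) (u : U0 R) :
    x • tmul R A y u = tmul R A (x * y) u := rfl

theorem add_tmul (x y : Unitization R A) (u : U0 R) :
    tmul R A (x + y) u = tmul R A x u + tmul R A y u := TensorProduct.add_tmul _ _ _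

theorem tmul_add (x : Unitization R A) (u v : U0 R) :
    tmul R A x (u + v) = tmul R A x u + tmul R A x v := TensorProduct.tmul_add _ _ _

theorem zero_tmul (u : U0 R) : tmul R A 0 u = 0 := TensorProduct.zero_tmul _ _

theorem tmul_zero (x : Unitization R A) : tmul R A x 0 = 0 := TensorProduct.tmul_zero _ _

theorem tmul_coeff_mul (x : Unitization R A) (r : R) (u : U0 R) :
    tmul R A x (U0.coeff R r * u) = tmul R A (r • x) u :=
  (TensorProduct.smul_tmul r x u).symm

@[elab_as_elim]
theorem induction {P : UEnv R A → Prop} (w : UEnv R A) (zero : P 0)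
    (tmul : ∀ x u, P (tmul R A x u)) (add : ∀ w w', P w → P w' → P (w + w')) : P w :=
  TensorProduct.induction_on w zero tmul add

/-- An additive map out of `U(A)` from a biadditive `R`-balanced one. -/
noncomputable def liftAdd {P : Type*} [AddCommGroup P] (f : Unitization R A →+ U0 R →+ P)
    (hf : ∀ (r : R) x u, f (r • x) u = f x (U0.coeff R r * u)) : UEnv R A →+ P :=
  TensorProduct.liftAddHom f hf

theorem liftAdd_tmul {P : Type*} [AddCommGroup P] (f : Unitization R A →+ U0 R →+ P)
    (hf : ∀ (r : R) x u, f (r • x) u = f x (U0.coeff R r * u)) (x : Unitization R A) (u : U0 R) :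
    liftAdd f hf (tmul R A x u) = f x u := rfl

/-- Left multiplication by `1 ⊗ u`, for `u ∈ U(0)`.  It is forced by the rules
`(1 ⊗ u)(1 ⊗ v) = 1 ⊗ u v` and `(1 ⊗ φ_p)(a ⊗ 1) = 0`: writing `y = r + a` with `r ∈ R` and
`a ∈ A`, one has `(1 ⊗ u)(y ⊗ v) = aug(u) a ⊗ v + 1 ⊗ u r v`. -/
noncomputable def lmul (u : U0 R) : UEnv R A →+ UEnv R A :=
  liftAdd
    (AddMonoidHom.mk' (fun y => AddMonoidHom.mk'
        (fun v => tmul R A (U0.aug R u • (y.snd : Unitization R A)) v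
          + tmul R A 1 (u * U0.coeff R y.fst * v))
        (fun v v' => by
          rw [tmul_add, mul_add, tmul_add]
          abel))
      (fun y y' => by
        ext v
        simp only [AddMonoidHom.mk'_apply, AddMonoidHom.add_apply, Unitization.fst_add,
          Unitization.snd_add, Unitization.inr_add, smul_add, add_tmul, map_add, mul_add, add_mul,
          tmul_add]
        abel))
    (fun r y v => by
      simp only [AddMonoidHom.mk'_apply, tmul_coeff_mul, Unitization.fst_smul,
        Unitization.snd_smul, Unitization.inr_smul, smul_eq_mul, map_mul, ← mul_assoc]
      rw [smul_comm r, mul_assoc u, ← map_mul, mul_comm r, map_mul, ← mul_assoc])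

theorem lmul_tmul (u : U0 R) (y : Unitization R A) (v : U0 R) :
    lmul u (tmul R A y v) = tmul R A (U0.aug R u • (y.snd : Unitization R A)) v
      + tmul R A 1 (u * U0.coeff R y.fst * v) := rfl

theorem lmul_add (u u' : U0 R) (w : UEnv R A) : lmul (u + u') w = lmul u w + lmul u' w := by
  induction w using induction with
  | zero => simp only [map_zero, add_zero]
  | tmul y v =>
    simp only [lmul_tmul, map_add, add_smul, add_tmul, add_mul, tmul_add]
    abel
  | add w w' h h' =>
    simp only [map_add, h, h']
    abel

theorem coeff_lmul (r : R) (w : UEnv R A) :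
    lmul (U0.coeff R r) w = (Unitization.inl r : Unitization R A) • w := by
  induction w using induction with
  | zero => simp only [map_zero, smul_zero]
  | tmul y v =>
    rw [lmul_tmul, U0.aug_coeff, ← map_mul, tmul_coeff_mul, ← add_tmul, smul_tmul]
    congr 1
    ext <;> simp
  | add w w' h h' => rw [map_add, smul_add, h, h']

theorem lmul_smul (u : U0 R) (y : Unitization R A) (w : UEnv R A) :
    lmul u (y • w) = (U0.aug R u • (y.snd : Unitization R A)) • w
      + lmul (u * U0.coeff R y.fst) w := by
  induction w using induction with
  | zero => simp only [map_zero, smul_zero, add_zero]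
  | tmul z v =>
    rw [smul_tmul, lmul_tmul, smul_tmul, lmul_tmul, ← add_assoc, ← add_tmul, Unitization.fst_mul,
      map_mul, map_mul, U0.aug_coeff, ← mul_assoc]
    congr 2
    ext
    · simp
    · simp only [Unitization.snd_add, Unitization.snd_smul, Unitization.snd_mul,
        Unitization.fst_inr, Unitization.snd_inr, zero_smul, smul_add, smul_mul_assoc, smul_smul,
        zero_add]
      abel
  | add w w' h h' =>
    rw [smul_add, map_add, h, h', smul_add, map_add]
    abel

theorem lmul_mul (u u' : U0 R) (w : UEnv R A) : lmul (u * u') w = lmul u (lmul u' w) := by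
  induction w using induction with
  | zero => simp only [map_zero]
  | tmul y v =>
    rw [lmul_tmul, lmul_tmul, map_add, lmul_tmul, lmul_tmul]
    simp only [Unitization.snd_smul, Unitization.fst_smul, Unitization.fst_inr,
      Unitization.snd_inr, Unitization.fst_one, Unitization.snd_one, Unitization.inr_zero,
      Unitization.inr_smul, smul_zero, map_zero, map_one, mul_zero, zero_mul, mul_one, smul_smul,
      map_mul, mul_assoc, zero_tmul, tmul_zero, add_zero, zero_add]
  | add w w' h h' => simp only [map_add, h, h']

/-- The product of `U(A)`, characterised by `(x ⊗ u) w = x • ((1 ⊗ u) w)`. -/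
noncomputable def mulHom : UEnv R A →+ UEnv R A →+ UEnv R A :=
  liftAdd
    (AddMonoidHom.mk' (fun x => AddMonoidHom.mk'
        (fun u => (DistribSMul.toAddMonoidHom _ x).comp (lmul u))
        (fun u u' => by
          ext w
          simp [lmul_add]))
      (fun x x' => by
        ext u w
        simp [add_smul]))
    (fun r x u => by
      ext w
      simp only [AddMonoidHom.mk'_apply, AddMonoidHom.coe_comp, Function.comp_apply,
        DistribSMul.toAddMonoidHom_apply, lmul_mul, coeff_lmul, smul_smul]
      congr 1
      ext <;> simp [mul_comm])

noncomputable instance : Mul (UEnv R A) := ⟨fun w w' => mulHom w w'⟩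

noncomputable instance : One (UEnv R A) := ⟨tmul R A 1 1⟩

theorem tmul_mul (x : Unitization R A) (u : U0 R) (w : UEnv R A) :
    tmul R A x u * w = x • lmul u w := rfl

theorem add_mul' (w w' z : UEnv R A) : (w + w') * z = w * z + w' * z := by
  change mulHom (w + w') z = mulHom w z + mulHom w' z
  rw [map_add, AddMonoidHom.add_apply]

theorem mul_add' (w z z' : UEnv R A) : w * (z + z') = w * z + w * z' :=
  map_add (mulHom w) z z'

theorem zero_mul' (z : UEnv R A) : 0 * z = 0 := by
  change mulHom 0 z = 0
  rw [map_zero, AddMonoidHom.zero_apply]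

theorem mul_zero' (w : UEnv R A) : w * 0 = 0 := map_zero (mulHom w)

theorem smul_mul' (x : Unitization R A) (w z : UEnv R A) : (x • w) * z = x • (w * z) := by
  induction w using induction with
  | zero => rw [smul_zero, zero_mul', smul_zero]
  | tmul y u => rw [smul_tmul, tmul_mul, tmul_mul, mul_smul]
  | add w w' h h' => rw [smul_add, add_mul', h, h', add_mul', smul_add]

theorem lmul_mul' (u : U0 R) (w z : UEnv R A) : lmul u w * z = lmul u (w * z) := by
  induction w using induction with
  | zero => rw [map_zero, zero_mul', map_zero]
  | tmul y v =>
    rw [lmul_tmul, add_mul', tmul_mul, tmul_mul, tmul_mul, lmul_smul, one_smul, lmul_mul]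
  | add w w' h h' => rw [map_add, add_mul', h, h', add_mul', map_add]

theorem mul_assoc' (w z t : UEnv R A) : w * z * t = w * (z * t) := by
  induction w using induction with
  | zero => rw [zero_mul', zero_mul', zero_mul']
  | tmul x u => rw [tmul_mul, tmul_mul, smul_mul', lmul_mul']
  | add w w' h h' => rw [add_mul', add_mul', add_mul', h, h']

theorem one_mul' (w : UEnv R A) : 1 * w = w := by
  change (1 : Unitization R A) • lmul 1 w = w
  rw [one_smul, ← map_one (U0.coeff R), coeff_lmul, Unitization.inl_one, one_smul]

theorem mul_one' (w : UEnv R A) : w * 1 = w := by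
  induction w using induction with
  | zero => rw [zero_mul']
  | tmul x u =>
    change x • lmul u (tmul R A 1 1) = _
    rw [lmul_tmul, Unitization.snd_one, Unitization.inr_zero, smul_zero, zero_tmul, zero_add,
      Unitization.fst_one, map_one, mul_one, mul_one, smul_tmul, mul_one]
  | add w w' h h' => rw [add_mul', h, h']

noncomputable instance : Ring (UEnv R A) :=
  { (inferInstance : AddCommGroup (UEnv R A)) with
    left_distrib := mul_add'
    right_distrib := add_mul'
    zero_mul := zero_mul'
    mul_zero := mul_zero'
    mul_assoc := mul_assoc'
    one_mul := one_mul'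
    mul_one := mul_one' }

variable (R A)

/-- The ring homomorphism `A₊ → U(A)`, `x ↦ x ⊗ 1`. -/
noncomputable def ofUnitization : Unitization R A →+* UEnv R A :=
  RingHom.mk' ⟨⟨fun x => tmul R A x 1, rfl⟩, fun x y => by
      change tmul R A (x * y) 1 = x • lmul 1 (tmul R A y 1)
      rw [← map_one (U0.coeff R), coeff_lmul, Unitization.inl_one, one_smul, smul_tmul]⟩
    fun x y => add_tmul x y 1

/-- The ring homomorphism `U(0) → U(A)`, `u ↦ 1 ⊗ u`. -/
noncomputable def ofU0 : U0 R →+* UEnv R A :=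
  RingHom.mk' ⟨⟨fun u => tmul R A 1 u, rfl⟩, fun u v => by
      change _ = (1 : Unitization R A) • lmul u (tmul R A 1 v)
      rw [one_smul, lmul_tmul, Unitization.snd_one, Unitization.inr_zero, smul_zero, zero_tmul,
        zero_add, Unitization.fst_one, map_one, mul_one]⟩
    fun u v => tmul_add 1 u v

variable {R A}

theorem ofUnitization_mul (x : Unitization R A) (w : UEnv R A) :
    ofUnitization R A x * w = x • w := by
  change x • lmul 1 w = _
  rw [← map_one (U0.coeff R), coeff_lmul, Unitization.inl_one, one_smul]

/-- `(x ⊗ 1)(1 ⊗ u) = x ⊗ u`. -/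
theorem ofUnitization_mul_ofU0 (x : Unitization R A) (u : U0 R) :
    ofUnitization R A x * ofU0 R A u = tmul R A x u := by
  rw [ofUnitization_mul]
  change tmul R A (x * 1) u = _
  rw [mul_one]

/-- `(1 ⊗ φ_p)(a ⊗ 1) = 0` for `a ∈ A`. -/
theorem φ_mul_inr (p : Nat.Primes) (a : A) :
    ofU0 R A (U0.φ R p) * ofUnitization R A (a : Unitization R A) = 0 := by
  change (1 : Unitization R A) • lmul _ (tmul R A _ 1) = 0
  rw [lmul_tmul, U0.aug_φ, zero_smul, zero_tmul, Unitization.fst_inr, map_zero, mul_zero,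
    zero_mul, tmul_zero, zero_add, smul_zero]

/-- The right multiplication of `R` on `U(A)`.  Since `R` is commutative, it may be recorded by an
instance of `Module R`, so that `U(A) ⊗[R] V` is the tensor product of the right `R`-module `U(A)`
with the `R`-module `V`.  (The left multiplication of `R` on `U(A)` is part of its left
`A₊`-module structure, and differs from the right multiplication.) -/
noncomputable instance rightModule : Module R (UEnv R A) where
  smul r w := w * ofU0 R A (U0.coeff R r)
  one_smul w := by
    change w * _ = w
    rw [map_one, map_one, mul_one]
  mul_smul r s w := by
    change w * _ = w * _ * _
    rw [mul_comm r, map_mul, map_mul, mul_assoc]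
  smul_zero r := zero_mul _
  smul_add r w w' := add_mul _ _ _
  add_smul r s w := by
    change w * _ = w * _ + w * _
    rw [map_add, map_add, mul_add]
  zero_smul w := by
    change w * _ = 0
    rw [map_zero, map_zero, mul_zero]

theorem right_smul_def (r : R) (w : UEnv R A) : r • w = w * ofU0 R A (U0.coeff R r) := rfl

instance : SMulCommClass R (Unitization R A) (UEnv R A) :=
  ⟨fun r x w => by rw [right_smul_def, right_smul_def, smul_mul']⟩

instance : SMulCommClass R (UEnv R A) (UEnv R A) :=
  ⟨fun r z w => by rw [right_smul_def, right_smul_def, smul_eq_mul, smul_eq_mul, mul_assoc]⟩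

end UEnv

set_option linter.unusedSectionVars false

/-! ### Congruences for binomial coefficients and for `Nat.uniformBell` -/

section Congruences

variable {p : ℕ} [hp : Fact p.Prime]

/-! Write γ_a(t) = Σ γ_n(a) t^n with γ_0(a) = 1, so that γ_{a+b} = γ_a γ_b. For a sequence x in an
A₊-module, `conv R n a x` is the coefficient of t^n in γ_a(t) x(t). Two inverse maps are built, both
resting on identities for `conv`.

From Ω to U(A) ⊗ V: for a U(A)-module M, the square-zero extension A ⊕ M is a DP algebra with γ_n(a,
w) = (γ_n(a), Σ_{i+j=n} γ_j(a) φ_i(w)), where φ_0 is read as 0 (`SqZeroExt.dpAlgebra`). Freeness of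
Γ_R(V) lifts v ↦ (v, 1 ⊗ v) to a section of A ⊕ M → A, with M = U(A) ⊗ V. Its second component is a
derivation, hence gives a linear map L on Ω, and compatibility with γ_n is the required formula for
e(dγ_n(a)).

From U(A) ⊗ V to Ω: for every DP algebra, U(0) acts on Ω. The coefficients ψ_n(a) of the logarithmic
derivative dγ_a(t)/γ_a(t) are additive in a, scale by r^n, vanish on products for n ≠ 1, and satisfy
ψ_m(γ_n(a)) = ψ_{mn}(a) for m ≠ 1. Thus r + a ↦ ψ_p(a) is a derivation into the Frobenius-twisted
p-torsion of Ω and induces φ_p, with φ_n(da) = ψ_n(a) (`kaehlerAct_phi`). The map is then (x ⊗ u) ⊗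
v ↦ x u dv. It is onto because dγ_n(a) = Σ γ_j(a) φ_i(da), and L is a left inverse because L
commutes with U(0) (`map_kaehlerAct`).

The arithmetic is confined to one point. In a primitive sequence, x_n is killed by all C(n, i) with
0 < i < n, hence by p if n is a power of p and by 1 if n > 1 is not a prime power. So the identities
for γ_m γ_n and γ_m ∘ γ_n need only hold modulo p in the coefficient of x_{p^f}, and exactly in that
of x_1. The congruences needed are `choose_cast_zmod_add` and `uniformBell_cast`, both consequences
of Lucas' theorem. -/

theorem choose_cast_zmod_prime_pow (f n k : ℕ) : (n.choose k : ZMod p)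
    = (n % p ^ f).choose (k % p ^ f) * (n / p ^ f).choose (k / p ^ f) := by
  induction f generalizing n k with
  | zero => simp [Nat.mod_one]
  | succ f ih =>
    have lucas : ∀ a b : ℕ, (a.choose b : ZMod p)
        = (a % p).choose (b % p) * (a / p).choose (b / p) := fun a b => by
      rw [← Nat.cast_mul]
      exact (ZMod.natCast_eq_natCast_iff _ _ _).2 Choose.choose_modEq_choose_mod_mul_choose_div_nat
    -- Lucas removes the last base-p digit, the induction hypothesis splits the quotient, and Lucas
    -- applied to n % p^(f+1) accounts for the regrouped low digits.
    rw [lucas, ih (n / p), lucas (n % p ^ (f + 1)), pow_succ', Nat.mod_mul_right_mod,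
      Nat.mod_mul_right_mod, Nat.mod_mul_right_div_self, Nat.mod_mul_right_div_self,
      Nat.div_div_eq_div_mul, Nat.div_div_eq_div_mul, mul_assoc]

/-- Quotients and remainders are parameters, so that a caller names the digits and `omega` verifies
them. -/
theorem choose_cast_zmod_of_eq (f : ℕ) {n k n₁ n₀ k₁ k₀ : ℕ} (hn : n = p ^ f * n₁ + n₀)
    (hk : k = p ^ f * k₁ + k₀) (hn₀ : n₀ < p ^ f) (hk₀ : k₀ < p ^ f) :
    (n.choose k : ZMod p) = n₀.choose k₀ * n₁.choose k₁ := by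
  have h0 : 0 < p ^ f := by omega
  rw [choose_cast_zmod_prime_pow f, hn, hk, Nat.mul_add_mod, Nat.mul_add_mod,
    Nat.mod_eq_of_lt hn₀, Nat.mod_eq_of_lt hk₀, Nat.mul_add_div h0, Nat.mul_add_div h0,
    Nat.div_eq_of_lt hn₀, Nat.div_eq_of_lt hk₀, add_zero, add_zero]

/-- The congruence `(1 + T) ^ k = (1 + T ^ q) (1 + T) ^ (k - q)` modulo `p`, where `q = p ^ f`. -/
theorem choose_cast_zmod_add (f : ℕ) (m n : ℕ) (h : p ^ f ≤ m + n) :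
    ((m + n).choose m : ZMod p)
      = (m + n - p ^ f).choose m + (m + n - p ^ f).choose n := by
  have h0 : 0 < p ^ f := pow_pos hp.out.pos _
  obtain ⟨l, hl⟩ := Nat.exists_eq_add_of_le h
  rw [hl, Nat.add_sub_cancel_left, choose_cast_zmod_prime_pow f, Nat.add_mod_left,
    Nat.add_div_left _ h0, choose_cast_zmod_prime_pow f l m]
  -- If m < q the second binomial vanishes and m has upper digit 0. Otherwise the claim is Pascal's
  -- rule in the upper digits.
  rcases Nat.lt_or_ge m (p ^ f) with hm | hm
  · rw [Nat.choose_eq_zero_of_lt (show l < n by omega), Nat.div_eq_of_lt hm]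
    simp
  · have hs : l.choose n = l.choose (m - p ^ f) := Nat.choose_symm_of_eq_add (by omega)
    obtain ⟨m', rfl⟩ := Nat.exists_eq_add_of_le hm
    rw [hs, Nat.add_sub_cancel_left, choose_cast_zmod_prime_pow f l m', Nat.add_mod_left,
      Nat.add_div_left _ h0, Nat.choose_succ_succ]
    push_cast
    ring

theorem mul_choose_eq (k : ℕ) {n : ℕ} (hn : 0 < n) (hk : 0 < k) :
    (k * n).choose n = k * (k * n - 1).choose (n - 1) := by
  obtain ⟨n, rfl⟩ := Nat.exists_eq_add_of_lt hn
  have h := Nat.add_one_mul_choose_eq (k * (n + 1) - 1) n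
  have h1 : k * (n + 1) - 1 + 1 = k * (n + 1) := Nat.sub_add_cancel (Nat.mul_pos hk (by omega))
  rw [h1, mul_right_comm] at h
  simpa using (Nat.eq_of_mul_eq_mul_right (by omega) h).symm

theorem choose_mul_cast_zmod_eq_zero {k : ℕ} (hk : p ∣ k) {n : ℕ} (hn : 0 < n) :
    ((k * n).choose n : ZMod p) = 0 := by
  rcases Nat.eq_zero_or_pos k with rfl | hk0
  · rw [Nat.zero_mul, Nat.choose_eq_zero_of_lt hn, Nat.cast_zero]
  · rw [mul_choose_eq k hn hk0, Nat.cast_mul, (ZMod.natCast_eq_zero_iff _ _).2 hk, zero_mul]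

/-- The binomial chooses the other n - 1 members of the block containing a fixed element. -/
theorem uniformBell_succ (m n : ℕ) :
    (m + 1).uniformBell n = ((m + 1) * n - 1).choose (n - 1) * m.uniformBell n := by
  rw [Nat.uniformBell_succ_left]
  congr 2
  rw [Nat.succ_mul]

/-- If `n` is not divisible by `q = p ^ f` and `uniformBell k n` is prime to `p`, then
`k (n % q) < q`. -/
theorem mul_lt_of_uniformBell_ne_zero (f : ℕ) {n n₁ r : ℕ} (hn : n = p ^ f * n₁ + r)
    (hn₁ : 0 < n₁) (hr : 0 < r) (hrq : r < p ^ f) (k : ℕ) (hk : (k.uniformBell n : ZMod p) ≠ 0) :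
    k * r < p ^ f := by
  induction k with
  | zero => omega
  | succ k ih =>
    rw [uniformBell_succ k, Nat.cast_mul] at hk
    have ih := ih (right_ne_zero_of_mul hk)
    by_contra! hq
    refine left_ne_zero_of_mul hk ?_
    have e : (k + 1) * n = p ^ f * ((k + 1) * n₁) + (k + 1) * r := by rw [hn]; ring
    have e' : (k + 1) * r = k * r + r := by ring
    -- Adding r to k r < q first reaches q here. On equality, k + 1 is a nontrivial divisor of q, so
    -- p divides the upper binomial; beyond q there is a carry, and the lower binomial is zero
    -- because (k + 1) r - q < r.
    rcases hq.eq_or_lt with hq | hq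
    · rw [choose_cast_zmod_of_eq f (n₁ := (k + 1) * n₁) (n₀ := p ^ f - 1) (k₁ := n₁) (k₀ := r - 1)
        (by omega) (by omega) (by omega) (by omega), choose_mul_cast_zmod_eq_zero _ hn₁, mul_zero]
      obtain ⟨j, -, hj⟩ := (Nat.dvd_prime_pow hp.out).1 (Dvd.intro _ hq.symm)
      rw [hj]
      refine dvd_pow_self p ?_
      rintro rfl
      rw [pow_zero] at hj
      rw [hj] at hq
      omega
    · have e2 : p ^ f * ((k + 1) * n₁ + 1) = p ^ f * ((k + 1) * n₁) + p ^ f := by ring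
      rw [choose_cast_zmod_of_eq f (n₁ := (k + 1) * n₁ + 1) (n₀ := (k + 1) * r - p ^ f - 1)
        (k₁ := n₁) (k₀ := r - 1) (by omega) (by omega) (by omega) (by omega),
        Nat.choose_eq_zero_of_lt (by omega)]
      simp

theorem uniformBell_cast_of_le (f : ℕ) {m n : ℕ} (hq : p ^ f ≤ n) :
    ((m + 1).uniformBell n : ZMod p)
      = m.uniformBell n * ((m + 1) * n - p ^ f).choose (n - p ^ f) := by
  have h0 : 0 < p ^ f := pow_pos hp.out.pos _
  rw [uniformBell_succ m, Nat.cast_mul, mul_comm]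
  -- The remaining binomials are not congruent in general, only when `uniformBell m n` is prime to
  -- p. This bounds m r below q, where r = n % q > 0.
  by_cases hB : (m.uniformBell n : ZMod p) = 0
  · rw [hB, zero_mul, zero_mul]
  congr 1
  obtain ⟨n₁, r, hn, hr⟩ : ∃ n₁ r, n = p ^ f * n₁ + r ∧ r < p ^ f :=
    ⟨n / p ^ f, n % p ^ f, (Nat.div_add_mod _ _).symm, Nat.mod_lt _ h0⟩
  have hn₁ : 0 < n₁ := by
    rcases Nat.eq_zero_or_pos n₁ with rfl | h
    · omega
    · exact h
  have e : (m + 1) * n = p ^ f * ((m + 1) * n₁) + (m + 1) * r := by rw [hn]; ring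
  have e1 : p ^ f * n₁ = p ^ f * (n₁ - 1) + p ^ f := by
    rw [← Nat.mul_succ, Nat.succ_eq_add_one, Nat.sub_add_cancel hn₁]
  have hM : 0 < (m + 1) * n₁ := Nat.mul_pos (by omega) hn₁
  have e2 : p ^ f * ((m + 1) * n₁) = p ^ f * ((m + 1) * n₁ - 1) + p ^ f := by
    rw [← Nat.mul_succ, Nat.succ_eq_add_one, Nat.sub_add_cancel hM]
  have e' : (m + 1) * r = m * r + r := by ring
  rcases Nat.eq_zero_or_pos r with rfl | hr0
  · rw [choose_cast_zmod_of_eq f (n₁ := (m + 1) * n₁ - 1) (n₀ := p ^ f - 1) (k₁ := n₁ - 1)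
      (k₀ := p ^ f - 1) (by omega) (by omega) (by omega) (by omega),
      choose_cast_zmod_of_eq f (n := (m + 1) * n - p ^ f) (k := n - p ^ f)
        (n₁ := (m + 1) * n₁ - 1) (n₀ := 0) (k₁ := n₁ - 1) (k₀ := 0)
      (by omega) (by omega) (by omega) (by omega)]
    simp
  have hlt := mul_lt_of_uniformBell_ne_zero f hn hn₁ hr0 hr m hB
  -- Below q, both sides are m + 1 times the same product, by absorption in one digit or the other.
  -- From q on, both sides vanish.
  rcases lt_trichotomy ((m + 1) * r) (p ^ f) with h | h | h
  · rw [choose_cast_zmod_of_eq f (n₁ := (m + 1) * n₁) (n₀ := (m + 1) * r - 1) (k₁ := n₁)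
      (k₀ := r - 1) (by omega) (by omega) (by omega) (by omega),
      choose_cast_zmod_of_eq f (n := (m + 1) * n - p ^ f) (k := n - p ^ f)
        (n₁ := (m + 1) * n₁ - 1) (n₀ := (m + 1) * r) (k₁ := n₁ - 1)
      (k₀ := r) (by omega) (by omega) (by omega) (by omega), mul_choose_eq _ hn₁ (by omega),
      mul_choose_eq _ hr0 (by omega)]
    push_cast
    ring
  · rw [choose_cast_zmod_of_eq f (n₁ := (m + 1) * n₁) (n₀ := (m + 1) * r - 1) (k₁ := n₁)
      (k₀ := r - 1) (by omega) (by omega) (by omega) (by omega),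
      choose_cast_zmod_of_eq f (n := (m + 1) * n - p ^ f) (k := n - p ^ f)
        (n₁ := (m + 1) * n₁) (n₀ := 0) (k₁ := n₁ - 1)
      (k₀ := r) (by omega) (by omega) (by omega) (by omega), choose_mul_cast_zmod_eq_zero _ hn₁,
      Nat.choose_eq_zero_of_lt hr0]
    · simp
    · obtain ⟨j, -, hj⟩ := (Nat.dvd_prime_pow hp.out).1 (Dvd.intro _ h)
      rw [hj]
      refine dvd_pow_self p ?_
      rintro rfl
      rw [pow_zero] at hj
      rw [hj] at h
      omega
  · have e3 : p ^ f * ((m + 1) * n₁ + 1) = p ^ f * ((m + 1) * n₁) + p ^ f := by ring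
    rw [choose_cast_zmod_of_eq f (n₁ := (m + 1) * n₁ + 1) (n₀ := (m + 1) * r - p ^ f - 1) (k₁ := n₁)
      (k₀ := r - 1) (by omega) (by omega) (by omega) (by omega),
      choose_cast_zmod_of_eq f (n := (m + 1) * n - p ^ f) (k := n - p ^ f)
        (n₁ := (m + 1) * n₁) (n₀ := (m + 1) * r - p ^ f) (k₁ := n₁ - 1)
      (k₀ := r) (by omega) (by omega) (by omega) (by omega),
      Nat.choose_eq_zero_of_lt (show (m + 1) * r - p ^ f - 1 < r - 1 by omega),
      Nat.choose_eq_zero_of_lt (show (m + 1) * r - p ^ f < r by omega)]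
    simp

theorem uniformBell_prime_pow_cast (e m : ℕ) : (m.uniformBell (p ^ e) : ZMod p) = 1 := by
  have h0 : 0 < p ^ e := pow_pos hp.out.pos _
  induction m with
  | zero => rw [Nat.uniformBell_zero_left, Nat.cast_one]
  | succ m ih =>
    have e1 : (m + 1) * p ^ e = p ^ e * m + p ^ e := by ring
    rw [uniformBell_succ m, Nat.cast_mul, ih, choose_cast_zmod_of_eq e (n₁ := m)
      (n₀ := p ^ e - 1) (k₁ := 0) (k₀ := p ^ e - 1) (by omega) (by omega) (by omega) (by omega)]
    simp

/-- Build the product one block at a time. At the step where the number of elements passes q, it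
equals q + s with 0 < s < n, and that factor contains C(s - 1, n - 1) = 0. -/
theorem uniformBell_cast_of_not_dvd (f : ℕ) {m n : ℕ} (hn : n < p ^ f) (hmn : p ^ f ≤ m * n)
    (hd : ¬ n ∣ p ^ f) : (m.uniformBell n : ZMod p) = 0 := by
  have h0 : 0 < p ^ f := pow_pos hp.out.pos _
  induction m with
  | zero => omega
  | succ m ih =>
    have hn0 : 0 < n := by
      rcases Nat.eq_zero_or_pos n with rfl | h
      · omega
      · exact h
    rw [uniformBell_succ m, Nat.cast_mul]
    have e1 : (m + 1) * n = m * n + n := by ring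
    rcases Nat.lt_or_ge (m * n) (p ^ f) with h | h
    · have hne : (m + 1) * n ≠ p ^ f := fun h => hd (Dvd.intro_left _ h)
      rw [choose_cast_zmod_of_eq f (n₁ := 1) (n₀ := (m + 1) * n - p ^ f - 1) (k₁ := 0)
        (k₀ := n - 1) (by omega) (by omega) (by omega) (by omega),
        Nat.choose_eq_zero_of_lt (by omega)]
      simp
    · rw [ih h, mul_zero]

/-- For `q = p ^ f`, the number of partitions of a set with `m n` elements into `m` blocks with `n`
elements is congruent modulo `p` to the number of those fixed by a cycle of length `q`. -/
theorem uniformBell_cast (f : ℕ) {m n : ℕ} (hq : p ^ f ≤ (m + 1) * n) :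
    ((m + 1).uniformBell n : ZMod p) = m.uniformBell n * ((m + 1) * n - p ^ f).choose (m * n)
      + if n ∣ p ^ f ∧ n ≠ p ^ f then ((m + 1 - p ^ f / n).uniformBell n : ZMod p) else 0 := by
  have h0 : 0 < p ^ f := pow_pos hp.out.pos _
  have e : (m + 1) * n = m * n + n := by ring
  -- The first term counts fixed partitions with the cycle inside one block. The second counts those
  -- where the cycle permutes several blocks: these exhaust the cycle, are determined by it, and
  -- leave m + 1 - q/n blocks. The size of n decides which kind can occur.
  rcases Nat.lt_or_ge n (p ^ f) with h | h
  · rw [Nat.choose_eq_zero_of_lt (by omega), Nat.cast_zero, mul_zero, zero_add]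
    split_ifs with hd
    · obtain ⟨e, -, rfl⟩ := (Nat.dvd_prime_pow hp.out).1 hd.1
      rw [uniformBell_prime_pow_cast, uniformBell_prime_pow_cast]
    · exact uniformBell_cast_of_not_dvd f h hq fun h' => hd ⟨h', h.ne⟩
  · rw [if_neg fun h' => h'.2 (le_antisymm (Nat.le_of_dvd h0 h'.1) h), add_zero,
      uniformBell_cast_of_le f h, Nat.choose_symm_of_eq_add (show (m + 1) * n - p ^ f
        = m * n + (n - p ^ f) by omega)]

end Congruences

/-! ### Primitive sequences -/

section Primitive

variable {M : Type v} [AddCommGroup M]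

/-- Sequences with the torsion of a sequence of additive divided powers `γ_n(w)`. -/
def IsPrimitiveSeq (x : ℕ → M) : Prop :=
  x 0 = 0 ∧ ∀ n i, 0 < i → i < n → n.choose i • x n = 0

/-- The gcd of the C(n, i) with 0 < i < n is p if n is a power of p and 1 otherwise, so the order of
x_n divides it. Integer coefficients of x_n matter only modulo that number. -/
theorem IsPrimitiveSeq.nsmul_eq {x : ℕ → M} (hx : IsPrimitiveSeq x) {n : ℕ} (hn : 1 < n) {c d : ℕ}
    (h : ∀ p f : ℕ, Fact p.Prime → n = p ^ f → (c : ZMod p) = d) : c • x n = d • x n := by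
  have ho : addOrderOf (x n) ∣ (Finset.Icc 1 (n - 1)).gcd n.choose :=
    Finset.dvd_gcd fun i hi => by
      rw [Finset.mem_Icc] at hi
      exact addOrderOf_dvd_of_nsmul_eq_zero (hx.2 n i (by omega) (by omega))
  rw [nsmul_eq_nsmul_iff_modEq]
  by_cases hpp : IsPrimePow n
  · rw [Choose.gcd_choose_eq_minFac_of_isPrimePow hpp] at ho
    obtain ⟨k, -, -, hk⟩ := (isPrimePow_nat_iff_bounded_log_minFac _).mp hpp
    exact ((ZMod.natCast_eq_natCast_iff _ _ _).1
      (h _ k ⟨Nat.minFac_prime hpp.ne_one⟩ hk)).of_dvd ho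
  · rw [Choose.gcd_choose_eq_one_of_not_isPrimePow hn hpp] at ho
    exact (Nat.modEq_one (a := c) (b := d)).of_dvd ho

theorem isPrimitiveSeq_of_isPrimePow {x : ℕ → M} (h0 : x 0 = 0)
    (h : ∀ n, 1 < n → ¬ IsPrimePow n → x n = 0)
    (hp : ∀ p e : ℕ, p.Prime → 0 < e → p • x (p ^ e) = 0) : IsPrimitiveSeq x := by
  refine ⟨h0, fun n i hi hin => ?_⟩
  by_cases hpp : IsPrimePow n
  · obtain ⟨p, e, hpr, he, rfl⟩ := (isPrimePow_nat_iff n).1 hpp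
    obtain ⟨c, hc⟩ := hpr.dvd_choose_pow hi.ne' hin.ne
    rw [hc, mul_comm, mul_smul, hp p e hpr he, smul_zero]
  · rw [h n (by omega) hpp, smul_zero]

end Primitive

/-! ### Convolution of a sequence with the divided powers of an element -/

namespace DPAlgebra

open Finset.HasAntidiagonal (antidiagonal)

variable (R : Type u) {A : Type w} {M : Type v} [CommRing R] [NonUnitalCommRing A] [Module R A]
  [IsScalarTower R A A] [SMulCommClass R A A]

theorem inr_iterate_mul (a b : A) (n : ℕ) :
    (Unitization.inr ((fun x => a * x)^[n] b) : Unitization R A)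
      = Unitization.inr a ^ n * Unitization.inr b := by
  induction n with
  | zero => simp
  | succ n ih => rw [Function.iterate_succ_apply', Unitization.inr_mul, ih, pow_succ', mul_assoc]

variable [DPAlgebra R A]

/-- The divided power `γ_n(a)` as an element of `A₊`, with `γ_0(a) = 1`. -/
noncomputable def gam (n : ℕ) (a : A) : Unitization R A :=
  if n = 0 then 1 else Unitization.inr (γ R n a)

@[simp]
theorem gam_zero (a : A) : gam R 0 a = 1 := if_pos rfl

theorem gam_of_pos {n : ℕ} (hn : 0 < n) (a : A) : gam R n a = Unitization.inr (γ R n a) :=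
  if_neg hn.ne'

theorem gam_one (a : A) : gam R 1 a = Unitization.inr a := by
  rw [gam_of_pos R one_pos, γ_one]

theorem sum_antidiagonal_eq_add_sum_Ioo {B : Type*} [AddCommMonoid B] (f : ℕ → ℕ → B) {n : ℕ}
    (hn : 0 < n) : ∑ ij ∈ antidiagonal n, f ij.1 ij.2
      = f 0 n + ∑ i ∈ Finset.Ioo 0 n, f i (n - i) + f n 0 := by
  obtain ⟨n, rfl⟩ := Nat.exists_eq_add_of_lt hn
  rw [Finset.Nat.sum_antidiagonal_eq_sum_range_succ, Finset.sum_range_succ,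
    FreeDP.sum_Ioo_eq_sum_range, Nat.sub_self]
  congr 1
  simp only [Nat.zero_add, Nat.add_sub_cancel]
  rw [Finset.sum_range_succ', add_comm, Nat.sub_zero]

theorem gam_add (n : ℕ) (a b : A) : gam R n (a + b)
    = ∑ ij ∈ antidiagonal n, gam R ij.1 a * gam R ij.2 b := by
  rcases Nat.eq_zero_or_pos n with rfl | hn
  · simp
  have hs : (Unitization.inr (∑ i ∈ Finset.Ioo 0 n, γ R i a * γ R (n - i) b) : Unitization R A)
      = ∑ i ∈ Finset.Ioo 0 n, gam R i a * gam R (n - i) b :=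
    (map_sum (Unitization.inrHom R R A) _ _).trans <| Finset.sum_congr rfl fun i hi => by
      rw [Finset.mem_Ioo] at hi
      rw [gam_of_pos R hi.1, gam_of_pos R (by omega), ← Unitization.inr_mul]
      rfl
  rw [sum_antidiagonal_eq_add_sum_Ioo (fun i j => gam R i a * gam R j b) hn, gam_of_pos R hn,
    γ_add n hn, gam_zero, gam_zero, one_mul, mul_one, Unitization.inr_add, Unitization.inr_add,
    hs, gam_of_pos R hn, gam_of_pos R hn]
  abel

theorem gam_smul (n : ℕ) (r : R) (a : A) : gam R n (r • a) = r ^ n • gam R n a := by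
  rcases Nat.eq_zero_or_pos n with rfl | hn
  · simp
  · rw [gam_of_pos R hn, γ_smul n hn, Unitization.inr_smul, gam_of_pos R hn]

theorem gam_at_zero {n : ℕ} (hn : 0 < n) : gam R n (0 : A) = 0 := by
  rw [← zero_smul R (0 : A), gam_smul, zero_pow hn.ne', zero_smul]

theorem gam_mul (n : ℕ) (a b : A) : gam R n (a * b) = Unitization.inr a ^ n * gam R n b := by
  rcases Nat.eq_zero_or_pos n with rfl | hn
  · simp
  · rw [gam_of_pos R hn, γ_mul n hn, inr_iterate_mul, gam_of_pos R hn]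

theorem gam_mul_gam (m n : ℕ) (a : A) :
    gam R m a * gam R n a = (m + n).choose m • gam R (m + n) a := by
  rcases Nat.eq_zero_or_pos m with rfl | hm
  · simp
  rcases Nat.eq_zero_or_pos n with rfl | hn
  · simp
  rw [gam_of_pos R hm, gam_of_pos R hn, ← Unitization.inr_mul, mul_γ m n hm hn,
    gam_of_pos R (by omega), ← Nat.cast_smul_eq_nsmul R, Unitization.inr_smul,
    Nat.cast_smul_eq_nsmul]

theorem gam_gam (m : ℕ) {n : ℕ} (hn : 0 < n) (a : A) :
    gam R m (γ R n a) = m.uniformBell n • gam R (m * n) a := by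
  rcases Nat.eq_zero_or_pos m with rfl | hm
  · rw [gam_zero, Nat.uniformBell_zero_left, zero_mul, gam_zero, one_smul]
  rw [gam_of_pos R hm, γ_γ m n hm hn, gam_of_pos R (Nat.mul_pos hm hn),
    ← Nat.cast_smul_eq_nsmul R, Unitization.inr_smul, Nat.cast_smul_eq_nsmul]

theorem inr_mul_gam (n : ℕ) (a : A) :
    Unitization.inr a * gam R n a = (n + 1) • gam R (n + 1) a := by
  rw [← gam_one, gam_mul_gam, Nat.choose_one_right, add_comm]

theorem inr_pow_eq (n : ℕ) (a : A) :
    (Unitization.inr a : Unitization R A) ^ n = n.factorial • gam R n a := by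
  induction n with
  | zero => simp
  | succ n ih =>
    rw [pow_succ', ih, mul_smul_comm, inr_mul_gam, smul_smul, Nat.factorial_succ, mul_comm]

variable [AddCommGroup M] [Module (Unitization R A) M]

/-- The sum `∑_{i + j = n} γ_j(a) x_i`. -/
noncomputable def conv (n : ℕ) (a : A) (x : ℕ → M) : M :=
  ∑ ij ∈ antidiagonal n, gam R ij.2 a • x ij.1

theorem conv_eq_sum_range (n : ℕ) (a : A) (x : ℕ → M) :
    conv R n a x = ∑ j ∈ Finset.range (n + 1), gam R (n - j) a • x j :=
  Finset.Nat.sum_antidiagonal_eq_sum_range_succ (fun i j => gam R j a • x i) n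

theorem conv_zero (a : A) {x : ℕ → M} (hx : x 0 = 0) : conv R 0 a x = 0 := by
  simp [conv, hx]

theorem conv_one (a : A) {x : ℕ → M} (hx : x 0 = 0) : conv R 1 a x = x 1 := by
  simp [conv_eq_sum_range, Finset.sum_range_succ, hx]

theorem conv_seq_add (n : ℕ) (a : A) (x y : ℕ → M) :
    conv R n a (fun j => x j + y j) = conv R n a x + conv R n a y := by
  simp only [conv, smul_add, Finset.sum_add_distrib]

theorem map_conv {M' : Type*} [AddCommGroup M'] [Module (Unitization R A) M']
    (L : M →ₗ[Unitization R A] M') (n : ℕ) (a : A) (x : ℕ → M) :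
    L (conv R n a x) = conv R n a fun j => L (x j) := by
  simp only [conv, map_sum, map_smul]

/-- Turns a convolution into the shape of the formula for e(dγ_n(a)). -/
theorem conv_eq_add_sum_Ioo {n : ℕ} (hn : 0 < n) (a : A) {x : ℕ → M} (hx : x 0 = 0) :
    conv R n a x = x n + ∑ i ∈ Finset.Ioo 0 n,
      (Unitization.inr (γ R i a) : Unitization R A) • x (n - i) := by
  rw [conv, sum_antidiagonal_eq_add_sum_Ioo (fun i j => gam R j a • x i) hn, hx, smul_zero,
    zero_add, gam_zero, one_smul, add_comm]
  congr 1
  refine Finset.sum_nbij' (n - ·) (n - ·) ?_ ?_ ?_ ?_ ?_ <;> intro i hi <;>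
    simp only [Finset.mem_Ioo] at hi ⊢
  any_goals omega
  rw [gam_of_pos R (by omega), Nat.sub_sub_self hi.2.le]

/-- A sequence is determined by its convolutions with the divided powers of `a`. -/
theorem conv_injective (a : A) {x y : ℕ → M} (h : ∀ n, conv R n a x = conv R n a y) : x = y := by
  funext n
  induction n using Nat.strong_induction_on with
  | _ n ih =>
    have h := h n
    rw [conv_eq_sum_range, conv_eq_sum_range, Finset.sum_range_succ, Finset.sum_range_succ,
      Finset.sum_congr rfl fun j hj => by rw [ih j (Finset.mem_range.1 hj)]] at h
    simpa using h

/-- Associativity of the product of power series, since γ_{a+b}(t) = γ_a(t) γ_b(t). -/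
theorem conv_add (n : ℕ) (a b : A) (x : ℕ → M) : conv R n (a + b) x
    = ∑ ij ∈ antidiagonal n, gam R ij.2 b • conv R ij.1 a x := by
  simp only [conv, gam_add, Finset.sum_smul, Finset.smul_sum, Finset.sum_sigma', smul_smul]
  refine Finset.sum_nbij' (fun s => ⟨(s.1.1 + s.2.1, s.2.2), (s.1.1, s.2.1)⟩)
    (fun s => ⟨(s.2.1, s.2.2 + s.1.2), (s.2.2, s.1.2)⟩) ?_ ?_ ?_ ?_ ?_ <;>
    rintro ⟨⟨i, j⟩, ⟨k, l⟩⟩ h <;>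
    simp only [Finset.mem_sigma, Finset.HasAntidiagonal.mem_antidiagonal, and_true] at h ⊢
  · omega
  · omega
  · obtain ⟨rfl, rfl⟩ := h
    rfl
  · obtain ⟨rfl, rfl⟩ := h
    rfl
  · rw [mul_comm]

/-- The substitution t ↦ r t. -/
theorem conv_smul (n : ℕ) (r : R) (a : A) (x : ℕ → M) :
    conv R n (r • a) (fun j => (Unitization.inl (r ^ j) : Unitization R A) • x j)
      = (Unitization.inl (r ^ n) : Unitization R A) • conv R n a x := by
  simp only [conv, Finset.smul_sum, smul_smul]
  refine Finset.sum_congr rfl fun ij hij => ?_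
  congr 1
  rw [gam_smul, ← Finset.HasAntidiagonal.mem_antidiagonal.1 hij, pow_add, Unitization.inl_mul,
    Algebra.smul_def, Unitization.algebraMap_eq_inl]
  ring

/-- Supplies the axiom for γ_n(ab): y plays the role of the sequence φ_j(a w' + b w), concentrated
in degree 1 because φ_j kills multiples of elements of A for j > 1. On the right only x_1 survives
multiplication by a^(n+1). -/
theorem conv_mul {x y : ℕ → M} (hx : IsPrimitiveSeq x) (hy0 : y 0 = 0) (hy : ∀ j, 1 < j → y j = 0)
    (a b : A) (w : M) (hy1 : y 1 = (Unitization.inr a : Unitization R A) • x 1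
      + (Unitization.inr b : Unitization R A) • w) (n : ℕ) :
    conv R (n + 1) (a * b) y = (Unitization.inr a : Unitization R A) ^ (n + 1) • conv R (n + 1) b x
      + ((n + 1) • (Unitization.inr a ^ n * gam R (n + 1) b)) • w := by
  have hl : conv R (n + 1) (a * b) y = gam R n (a * b) • y 1 := by
    rw [conv_eq_sum_range, Finset.sum_eq_single 1]
    · rw [Nat.add_sub_cancel]
    · intro j _ hj
      rcases Nat.eq_zero_or_pos j with rfl | hj0
      · rw [hy0, smul_zero]
      · rw [hy j (by omega), smul_zero]
    · simp
  have hr : (Unitization.inr a : Unitization R A) ^ (n + 1) • conv R (n + 1) b x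
      = (Unitization.inr a ^ (n + 1) * gam R n b) • x 1 := by
    rw [conv_eq_sum_range, Finset.smul_sum, Finset.sum_eq_single 1, Nat.add_sub_cancel, smul_smul]
    · intro j hj hj1
      rw [Finset.mem_range] at hj
      rcases Nat.eq_zero_or_pos j with rfl | hj0
      · rw [hx.1, smul_zero, smul_zero]
      · have hjx : j • x j = 0 := by
          rw [← hx.2 j 1 one_pos (by omega), Nat.choose_one_right]
        obtain ⟨c, hc⟩ := Nat.dvd_factorial hj0 (show j ≤ n + 1 by omega)
        rw [inr_pow_eq, hc, smul_comm, smul_assoc, mul_comm, mul_smul, smul_comm _ (gam R _ a),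
          hjx, smul_zero, smul_zero, smul_zero]
    · simp
  rw [hl, hr, hy1, gam_mul, smul_add, smul_smul, smul_smul]
  congr 2
  · ring
  · rw [mul_assoc, mul_comm (gam R n b), inr_mul_gam, mul_smul_comm]

theorem gam_smul_conv (m n : ℕ) (a : A) (x : ℕ → M) :
    gam R m a • conv R n a x = ∑ j ∈ Finset.range (m + n + 1),
      (m + n - j).choose m • gam R (m + n - j) a • x j := by
  rw [conv_eq_sum_range, Finset.smul_sum]
  -- The sum may be extended to j ≤ m + n because the binomial vanishes for j > n. Then products
  -- with different m and n share one index range.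
  rw [← Finset.sum_subset (Finset.range_subset_range.2 (show n + 1 ≤ m + n + 1 by omega))]
  · refine Finset.sum_congr rfl fun j hj => ?_
    rw [Finset.mem_range] at hj
    rw [smul_smul, gam_mul_gam, smul_assoc, show m + (n - j) = m + n - j by omega]
  · intro j hj' hj
    rw [Finset.mem_range] at hj hj'
    rw [Nat.choose_eq_zero_of_lt (by omega), zero_smul]

/-- The Leibniz rule for γ_m γ_n. Comparing coefficients of x_j, j = 1 is Pascal's rule, and j = p^f
is `choose_cast_zmod_add`. -/
theorem choose_smul_conv {x : ℕ → M} (hx : IsPrimitiveSeq x) {m n : ℕ} (hm : 0 < m)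
    (a : A) : (m + n).choose m • conv R (m + n) a x
      = gam R m a • conv R n a x + gam R n a • conv R m a x := by
  rw [gam_smul_conv, gam_smul_conv, add_comm n m, ← Finset.sum_add_distrib, conv_eq_sum_range,
    Finset.smul_sum]
  refine Finset.sum_congr rfl fun j hj => ?_
  rw [Finset.mem_range] at hj
  rw [← add_smul, smul_comm, smul_comm _ (gam R (m + n - j) a)]
  congr 1
  rcases Nat.lt_trichotomy j 1 with h | rfl | h
  · obtain rfl : j = 0 := by omega
    rw [hx.1, smul_zero, smul_zero]
  · congr 1
    obtain ⟨m, rfl⟩ := Nat.exists_eq_add_of_lt hm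
    have h1 : (0 + m + 1 + n - 1).choose n = (0 + m + 1 + n - 1).choose m :=
      Nat.choose_symm_of_eq_add (by omega)
    rw [h1, show 0 + m + 1 + n = (m + n) + 1 by omega, Nat.add_sub_cancel, Nat.zero_add,
      Nat.choose_succ_succ, add_comm]
  · refine hx.nsmul_eq h fun p f hp hf => ?_
    rw [hf, Nat.cast_add]
    exact choose_cast_zmod_add f m n (by omega)

/-- Supplies the axiom for γ_m ∘ γ_n: y_l stands for φ_l applied to the n-th convolution, in which
only φ_l φ_n = φ_{ln} survives when l ≠ 1. The coefficient of x_j receives a contribution from l = 1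
and, if n divides j and n ≠ j, one from l = j / n. For j = p^f their sum is `uniformBell_cast`. -/
theorem conv_gamma {x y : ℕ → M} (hx : IsPrimitiveSeq x) {n : ℕ} (hn : 0 < n) (a : A)
    (hy1 : y 1 = conv R n a x) (hy : ∀ l, l ≠ 1 → y l = x (l * n)) (m : ℕ) :
    conv R m (γ R n a) y = m.uniformBell n • conv R (m * n) a x := by
  rcases m with _ | m
  · rw [conv_zero R _ (by rw [hy 0 (by omega), Nat.zero_mul, hx.1]), Nat.zero_mul,
      conv_zero R _ hx.1, smul_zero]
  have e : (m + 1) * n = m * n + n := by ring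
  have h1 : conv R (m + 1) (γ R n a) y = gam R m (γ R n a) • conv R n a x
      + ∑ l ∈ Finset.range (m + 1 + 1), if l ≠ 1 then
        gam R (m + 1 - l) (γ R n a) • x (l * n) else 0 := by
    rw [conv_eq_sum_range, ← Finset.add_sum_erase _ _ (show 1 ∈ Finset.range (m + 1 + 1) by simp),
      ← Finset.add_sum_erase (Finset.range (m + 1 + 1)) _
        (show 1 ∈ Finset.range (m + 1 + 1) by simp), if_neg (not_not.2 rfl), zero_add, hy1, Nat.add_sub_cancel]
    congr 1
    refine Finset.sum_congr rfl fun l hl => ?_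
    rw [if_pos (Finset.ne_of_mem_erase hl), hy l (Finset.ne_of_mem_erase hl)]
  -- Reindexing by j = l n; the condition n ≠ j records l ≠ 1.
  have h2 : (∑ l ∈ Finset.range (m + 1 + 1), if l ≠ 1 then
        gam R (m + 1 - l) (γ R n a) • x (l * n) else 0)
      = ∑ j ∈ Finset.range ((m + 1) * n + 1), if n ∣ j ∧ n ≠ j then
        (m + 1 - j / n).uniformBell n • gam R ((m + 1) * n - j) a • x j else 0 := by
    rw [← Finset.sum_filter, ← Finset.sum_filter]
    refine Finset.sum_nbij (· * n) ?_ (fun _ _ _ _ h => Nat.eq_of_mul_eq_mul_right hn h) ?_ ?_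
    · intro l hl
      simp only [Finset.mem_filter, Finset.mem_range] at hl ⊢
      refine ⟨Nat.lt_succ_of_le (Nat.mul_le_mul_right n (by omega)), Nat.dvd_mul_left n l,
        fun h => hl.2 (Nat.eq_of_mul_eq_mul_right hn (by rw [← h, one_mul]))⟩
    · intro j hj
      simp only [Finset.coe_filter, Finset.mem_range, Set.mem_ofPred_eq] at hj
      obtain ⟨hj, ⟨l, rfl⟩, hne⟩ := hj
      refine ⟨l, ?_, mul_comm l n⟩
      simp only [Finset.coe_filter, Finset.mem_range, Set.mem_ofPred_eq]
      refine ⟨Nat.lt_succ_of_le (Nat.le_of_mul_le_mul_left (?_ : n * l ≤ n * (m + 1)) hn), ?_⟩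
      · rw [mul_comm n (m + 1)]
        omega
      · rintro rfl
        exact hne (mul_one n).symm
    · intro l hl
      rw [gam_gam R _ hn, Nat.mul_div_cancel _ hn, Nat.sub_mul, smul_assoc]
  rw [h1, h2, gam_gam R m hn, smul_assoc, gam_smul_conv, ← e, Finset.smul_sum,
    ← Finset.sum_add_distrib, conv_eq_sum_range, Finset.smul_sum]
  refine Finset.sum_congr rfl fun j hj => ?_
  rw [Finset.mem_range] at hj
  rw [← zero_smul ℕ (gam R ((m + 1) * n - j) a • x j), ← ite_smul, smul_smul, ← add_smul,
    smul_comm, smul_comm _ (gam R ((m + 1) * n - j) a)]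
  congr 1
  rcases Nat.lt_trichotomy j 1 with h | rfl | h
  · obtain rfl : j = 0 := by omega
    rw [hx.1, smul_zero, smul_zero]
  · congr 1
    -- There is no torsion to use in x_1, but the extra term is absent and the recursion for
    -- `uniformBell` gives an exact equality.
    rw [if_neg fun h => h.2 (Nat.dvd_one.1 h.1), add_zero, uniformBell_succ, mul_comm]
    congr 1
    exact Nat.choose_symm_of_eq_add (by omega)
  · refine hx.nsmul_eq h fun p f hp hf => ?_
    subst hf
    push_cast
    exact (uniformBell_cast f (by omega)).symm

end DPAlgebra

/-! ### Square-zero extensions of divided power algebras -/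

section SqZeroExt

variable (R : Type u) (A : Type w) (M : Type v) [CommRing R] [NonUnitalCommRing A] [Module R A]
  [IsScalarTower R A A] [SMulCommClass R A A] [AddCommGroup M] [Module (Unitization R A) M]

/-- The operations `φ_n` of a `U(A)`-module on the underlying `A₊`-module. -/
structure PhiAction where
  φ : ℕ → M →+ M
  one : ∀ w, φ 1 w = w
  primitive : ∀ w, IsPrimitiveSeq fun n => φ n w
  mul : ∀ m n w, φ m (φ n w) = φ (m * n) w
  smul_inl : ∀ n (r : R) w, φ n ((Unitization.inl r : Unitization R A) • w)
    = (Unitization.inl (r ^ n) : Unitization R A) • φ n w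
  smul_inr : ∀ n (a : A) w, 1 < n → φ n ((Unitization.inr a : Unitization R A) • w) = 0

/-- The square-zero extension `A ⊕ M` of the non-unital algebra `A` by the `A₊`-module `M`. -/
@[ext]
structure SqZeroExt (R : Type u) (A : Type w) (M : Type v) where
  fst : A
  snd : M

namespace SqZeroExt

variable {R A M}

instance : Zero (SqZeroExt R A M) := ⟨⟨0, 0⟩⟩

instance : Add (SqZeroExt R A M) := ⟨fun y z => ⟨y.1 + z.1, y.2 + z.2⟩⟩

instance : Neg (SqZeroExt R A M) := ⟨fun y => ⟨-y.1, -y.2⟩⟩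

instance : Mul (SqZeroExt R A M) :=
  ⟨fun y z => ⟨y.1 * z.1, (Unitization.inr y.1 : Unitization R A) • z.2
    + (Unitization.inr z.1 : Unitization R A) • y.2⟩⟩

instance : SMul R (SqZeroExt R A M) :=
  ⟨fun r z => ⟨r • z.1, (Unitization.inl r : Unitization R A) • z.2⟩⟩

@[simp] theorem fst_zero : (0 : SqZeroExt R A M).1 = 0 := rfl
@[simp] theorem snd_zero : (0 : SqZeroExt R A M).2 = 0 := rfl
@[simp] theorem fst_add (y z : SqZeroExt R A M) : (y + z).1 = y.1 + z.1 := rfl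
@[simp] theorem snd_add (y z : SqZeroExt R A M) : (y + z).2 = y.2 + z.2 := rfl
@[simp] theorem fst_mul (y z : SqZeroExt R A M) : (y * z).1 = y.1 * z.1 := rfl
@[simp] theorem snd_mul (y z : SqZeroExt R A M) :
    (y * z).2 = (Unitization.inr y.1 : Unitization R A) • z.2
      + (Unitization.inr z.1 : Unitization R A) • y.2 := rfl
@[simp] theorem fst_smul (r : R) (z : SqZeroExt R A M) : (r • z).1 = r • z.1 := rfl
@[simp] theorem snd_smul (r : R) (z : SqZeroExt R A M) :
    (r • z).2 = (Unitization.inl r : Unitization R A) • z.2 := rfl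

@[simp] theorem fst_neg (y : SqZeroExt R A M) : (-y).1 = -y.1 := rfl
@[simp] theorem snd_neg (y : SqZeroExt R A M) : (-y).2 = -y.2 := rfl

instance : AddCommGroup (SqZeroExt R A M) :=
  { AddGroup.ofLeftAxioms (G := SqZeroExt R A M)
      (fun x y z => by ext <;> simp [add_assoc])
      (fun x => by ext <;> simp)
      (fun x => by ext <;> simp) with
    add_comm := fun x y => by ext <;> simp [add_comm] }

instance : NonUnitalCommRing (SqZeroExt R A M) :=
  { (inferInstance : AddCommGroup (SqZeroExt R A M)) with
    left_distrib := fun x y z => by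
      ext
      · simp [mul_add]
      · simp only [snd_mul, snd_add, fst_add, Unitization.inr_add, smul_add, add_smul]
        abel
    right_distrib := fun x y z => by
      ext
      · simp [add_mul]
      · simp only [snd_mul, snd_add, fst_add, Unitization.inr_add, smul_add, add_smul]
        abel
    zero_mul := fun x => by ext <;> simp
    mul_zero := fun x => by ext <;> simp
    mul_assoc := fun x y z => by
      ext
      · simp [mul_assoc]
      · simp only [snd_mul, fst_mul, Unitization.inr_mul, smul_add, smul_smul]
        rw [mul_comm (Unitization.inr z.1 : Unitization R A),
          mul_comm (Unitization.inr z.1 : Unitization R A), add_assoc]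
    mul_comm := fun x y => by
      ext
      · simp [mul_comm]
      · simp only [snd_mul]
        rw [add_comm] }

instance : Module R (SqZeroExt R A M) where
  one_smul z := by ext <;> simp
  mul_smul r s z := by ext <;> simp [mul_smul]
  smul_add r y z := by ext <;> simp
  smul_zero r := by ext <;> simp
  add_smul r s z := by ext <;> simp [add_smul]
  zero_smul z := by ext <;> simp

instance : IsScalarTower R (SqZeroExt R A M) (SqZeroExt R A M) :=
  ⟨fun r y z => by
    ext
    · exact smul_mul_assoc r y.1 z.1
    · simp only [smul_eq_mul, snd_mul, snd_smul, fst_smul, smul_add, smul_smul]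
      congr 2
      · ext <;> simp
      · rw [mul_comm]⟩

/-- The projection to `A`. -/
def fstHom : SqZeroExt R A M →+ A := ⟨⟨fst, rfl⟩, fun _ _ => rfl⟩

/-- The projection to `M`. -/
def sndHom : SqZeroExt R A M →+ M := ⟨⟨snd, rfl⟩, fun _ _ => rfl⟩

theorem fst_sum {ι : Type*} (s : Finset ι) (f : ι → SqZeroExt R A M) :
    (∑ i ∈ s, f i).1 = ∑ i ∈ s, (f i).1 := map_sum fstHom f s

theorem snd_sum {ι : Type*} (s : Finset ι) (f : ι → SqZeroExt R A M) :
    (∑ i ∈ s, f i).2 = ∑ i ∈ s, (f i).2 := map_sum sndHom f s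

theorem fst_nsmul (n : ℕ) (z : SqZeroExt R A M) : (n • z).1 = n • z.1 := map_nsmul fstHom n z

theorem snd_nsmul (n : ℕ) (z : SqZeroExt R A M) : (n • z).2 = n • z.2 := map_nsmul sndHom n z

theorem iterate_mul_fst (y z : SqZeroExt R A M) (n : ℕ) :
    ((fun x => y * x)^[n] z).1 = (fun x => y.1 * x)^[n] z.1 := by
  induction n with
  | zero => rfl
  | succ n ih => rw [Function.iterate_succ_apply', Function.iterate_succ_apply', fst_mul, ih]

theorem iterate_mul_snd (y z : SqZeroExt R A M) (n : ℕ) :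
    ((fun x => y * x)^[n + 1] z).2 = (Unitization.inr y.1 : Unitization R A) ^ (n + 1) • z.2
      + ((n + 1) • ((Unitization.inr y.1 : Unitization R A) ^ n * Unitization.inr z.1)) • y.2 := by
  induction n with
  | zero => simp
  | succ n ih =>
    rw [Function.iterate_succ_apply', snd_mul, ih, iterate_mul_fst, DPAlgebra.inr_iterate_mul,
      smul_add, smul_smul, smul_smul, ← pow_succ', add_assoc, ← add_smul, mul_smul_comm,
      ← mul_assoc, ← pow_succ', ← succ_nsmul]

variable [DPAlgebra R A]

open DPAlgebra

/-- The divided power structure on `A ⊕ M` given by the operations `φ_n` on `M`. -/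
noncomputable abbrev dpAlgebra (Φ : PhiAction R A M) : DPAlgebra R (SqZeroExt R A M) where
  γ n z := ⟨γ R n z.1, conv R n z.1 fun j => Φ.φ j z.2⟩
  γ_zero z := by
    refine SqZeroExt.ext (γ_zero _) ?_
    simp only
    rw [conv_zero R z.1 (Φ.primitive z.2).1, snd_zero]
  γ_one z := by
    refine SqZeroExt.ext (γ_one _) ?_
    simp only
    rw [conv_one R z.1 (Φ.primitive z.2).1, Φ.one]
  γ_add n hn y z := by
    refine SqZeroExt.ext ?_ ?_
    · simp only [fst_add, fst_sum, fst_mul]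
      exact γ_add n hn _ _
    · simp only [snd_add, fst_add, snd_sum, snd_mul, map_add, Finset.sum_add_distrib]
      rw [conv_seq_add, conv_add, add_comm y.1, conv_add,
        ← Finset.Nat.sum_antidiagonal_swap (f := fun ij => gam R ij.2 y.1 • _)]
      simp only [Prod.fst_swap, Prod.snd_swap]
      rw [sum_antidiagonal_eq_add_sum_Ioo (fun i j => gam R j z.1 • conv R i y.1 fun j =>
          Φ.φ j y.2) hn, sum_antidiagonal_eq_add_sum_Ioo (fun i j => gam R i y.1 • conv R j z.1
          fun j => Φ.φ j z.2) hn, conv_zero R _ (Φ.primitive y.2).1,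
          conv_zero R _ (Φ.primitive z.2).1]
      have h1 : ∑ i ∈ Finset.Ioo 0 n, gam R (n - i) z.1 • conv R i y.1 (fun j => Φ.φ j y.2)
          = ∑ i ∈ Finset.Ioo 0 n, (Unitization.inr (γ R (n - i) z.1) : Unitization R A) •
            conv R i y.1 (fun j => Φ.φ j y.2) :=
        Finset.sum_congr rfl fun i hi => by
          rw [Finset.mem_Ioo] at hi
          rw [gam_of_pos R (by omega)]
      have h2 : ∑ i ∈ Finset.Ioo 0 n, gam R i y.1 • conv R (n - i) z.1 (fun j => Φ.φ j z.2)
          = ∑ i ∈ Finset.Ioo 0 n, (Unitization.inr (γ R i y.1) : Unitization R A) •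
            conv R (n - i) z.1 (fun j => Φ.φ j z.2) :=
        Finset.sum_congr rfl fun i hi => by
          rw [Finset.mem_Ioo] at hi
          rw [gam_of_pos R hi.1]
      rw [h1, h2, gam_zero, gam_zero, one_smul, one_smul, smul_zero, smul_zero]
      abel
  γ_mul n hn y z := by
    obtain ⟨n, rfl⟩ := Nat.exists_eq_add_of_lt hn
    rw [Nat.zero_add]
    refine SqZeroExt.ext ?_ ?_
    · rw [iterate_mul_fst]
      exact γ_mul (n + 1) (by omega) _ _
    · rw [iterate_mul_snd]
      simp only [fst_mul, snd_mul]
      rw [← gam_of_pos R (Nat.succ_pos n)]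
      refine conv_mul R (Φ.primitive z.2) (Φ.primitive _).1 (fun j hj => ?_) _ _ _ ?_ n
      · rw [map_add, Φ.smul_inr j _ _ hj, Φ.smul_inr j _ _ hj, add_zero]
      · rw [Φ.one, Φ.one]
  γ_smul n hn r z := by
    refine SqZeroExt.ext (γ_smul n hn _ _) ?_
    simp only [fst_smul, snd_smul, Φ.smul_inl]
    exact conv_smul R n r z.1 _
  mul_γ m n hm hn z := by
    refine SqZeroExt.ext (by rw [fst_nsmul]; exact mul_γ m n hm hn _) ?_
    rw [snd_nsmul, snd_mul]
    simp only
    rw [choose_smul_conv R (Φ.primitive z.2) hm, gam_of_pos R hm, gam_of_pos R hn]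
  γ_γ m n hm hn z := by
    refine SqZeroExt.ext (by rw [fst_nsmul]; exact γ_γ m n hm hn _) ?_
    rw [snd_nsmul]
    simp only
    refine conv_gamma R (Φ.primitive z.2) hn z.1 (by rw [Φ.one]) (fun l hl => ?_) m
    rcases Nat.eq_zero_or_pos l with rfl | hl0
    · rw [zero_mul]
      exact (Φ.primitive _).1.trans (Φ.primitive _).1.symm
    -- For l > 1, φ_l kills every summand with a divided power of positive index, leaving φ_l φ_n.
    simp only [conv_eq_sum_range]
    rw [Finset.sum_range_succ, map_add, map_sum, Finset.sum_eq_zero, zero_add, Nat.sub_self,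
      gam_zero, one_smul, Φ.mul]
    intro j hj
    rw [Finset.mem_range] at hj
    rw [gam_of_pos R (by omega), Φ.smul_inr l _ _ (by omega)]

end SqZeroExt

end SqZeroExt

/-! ### Divided powers and Kähler differentials -/

section Kaehler

open DPAlgebra KaehlerDifferential

variable {R : Type u} {A : Type w} [CommRing R] [NonUnitalCommRing A] [Module R A]
  [IsScalarTower R A A] [SMulCommClass R A A] [DPAlgebra R A]

variable (R) in
/-- The coefficient of `t ^ n` in the logarithmic derivative of `∑ γ_n(a) t ^ n`. -/
noncomputable def dlogγ (a : A) (n : ℕ) : Ω[Unitization R A⁄R] :=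
  conv R n (-a) fun j => D R (Unitization R A) (gam R j a)

/-- The series of -a is inverse to that of a, so multiplying dγ_a(t)/γ_a(t) by γ_a(t) returns
dγ_a(t). -/
theorem conv_dlogγ (n : ℕ) (a : A) :
    conv R n a (dlogγ R a) = D R (Unitization R A) (gam R n a) := by
  change ∑ ij ∈ Finset.HasAntidiagonal.antidiagonal n, gam R ij.2 a • conv R ij.1 (-a) _ = _
  rw [← conv_add, neg_add_cancel, conv_eq_sum_range, Finset.sum_range_succ, Nat.sub_self, gam_zero,
    one_smul, Finset.sum_eq_zero, zero_add]
  intro j hj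
  rw [gam_at_zero R (Nat.sub_pos_of_lt (Finset.mem_range.1 hj)), zero_smul]

theorem dlogγ_zero (a : A) : dlogγ R a 0 = 0 := by
  simp [dlogγ, conv_eq_sum_range]

theorem dlogγ_one (a : A) : dlogγ R a 1 = D R (Unitization R A) (Unitization.inr a) := by
  rw [← gam_one, ← conv_dlogγ, conv_one R a (dlogγ_zero (R := R) a)]

/-- A logarithmic derivative is identified by multiplying back. The formulas for sums, scalars,
products and divided powers follow from the matching identities for `conv`. -/
theorem dlogγ_eq_of_conv {a : A} {x : ℕ → Ω[Unitization R A⁄R]} (h0 : x 0 = 0)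
    (h : ∀ n, conv R (n + 1) a x = D R (Unitization R A) (gam R (n + 1) a)) : dlogγ R a = x := by
  refine conv_injective R a fun n => ?_
  rcases n with _ | n
  · rw [conv_zero R a h0, conv_zero R a (dlogγ_zero (R := R) a)]
  · rw [conv_dlogγ, h]

theorem dlogγ_add (a b : A) (n : ℕ) : dlogγ R (a + b) n = dlogγ R a n + dlogγ R b n := by
  refine congrFun (dlogγ_eq_of_conv (x := fun j => dlogγ R a j + dlogγ R b j) ?_ fun n => ?_) n
  · simp only [dlogγ_zero, add_zero]
  · rw [conv_seq_add, conv_add R _ a b, add_comm a b, conv_add R _ b a,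
      ← Finset.Nat.sum_antidiagonal_swap (f := fun ij => gam R ij.2 b • conv R ij.1 a (dlogγ R a)),
      gam_add, map_sum, ← Finset.sum_add_distrib]
    refine Finset.sum_congr rfl fun ij _ => ?_
    rw [Derivation.leibniz, conv_dlogγ, conv_dlogγ]
    rfl

theorem dlogγ_smul (r : R) (a : A) (n : ℕ) :
    dlogγ R (r • a) n = (Unitization.inl (r ^ n) : Unitization R A) • dlogγ R a n := by
  refine congrFun (dlogγ_eq_of_conv (x := fun j => (Unitization.inl (r ^ j) : Unitization R A) •
    dlogγ R a j) ?_ fun n => ?_) n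
  · simp only [dlogγ_zero, smul_zero]
  · rw [conv_smul, conv_dlogγ, gam_smul, Derivation.map_smul, ← Unitization.algebraMap_eq_inl,
      algebraMap_smul]

/-- Differentiate γ_m(a) γ_n(a) = C(m+n, m) γ_{m+n}(a). The terms ψ_j with j < m + n already satisfy
the Leibniz rule by induction, so C(m+n, m) ψ_{m+n} is what remains and must vanish. -/
theorem isPrimitiveSeq_dlogγ (a : A) : IsPrimitiveSeq (dlogγ R a) := by
  refine ⟨dlogγ_zero a, fun N => ?_⟩
  induction N using Nat.strong_induction_on with
  | _ N ih =>
    intro m hm hmN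
    obtain ⟨n, rfl⟩ := Nat.exists_eq_add_of_le hmN.le
    -- Truncation below m + n makes the sequence primitive by the induction hypothesis, so
    -- `choose_smul_conv` applies without circularity.
    set x : ℕ → Ω[Unitization R A⁄R] := fun j => if j < m + n then dlogγ R a j else 0 with hx
    have hxp : IsPrimitiveSeq x := by
      refine ⟨by simp [hx, dlogγ_zero], fun k i hi hik => ?_⟩
      by_cases hk : k < m + n
      · simp only [hx, if_pos hk, ih k hk i hi hik]
      · simp only [hx, if_neg hk, smul_zero]
    have hlt : ∀ k, k < m + n → conv R k a x = D R (Unitization R A) (gam R k a) := by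
      intro k hk
      rw [← conv_dlogγ, conv_eq_sum_range, conv_eq_sum_range]
      refine Finset.sum_congr rfl fun j hj => ?_
      rw [Finset.mem_range] at hj
      simp only [hx, if_pos (show j < m + n by omega)]
    have heq : conv R (m + n) a x + dlogγ R a (m + n)
        = D R (Unitization R A) (gam R (m + n) a) := by
      rw [← conv_dlogγ, conv_eq_sum_range, conv_eq_sum_range, Finset.sum_range_succ,
        Finset.sum_range_succ _ (m + n)]
      simp only [hx, lt_irrefl, if_false, smul_zero, add_zero, Nat.sub_self, gam_zero, one_smul]
      congr 1
      refine Finset.sum_congr rfl fun j hj => ?_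
      rw [if_pos (Finset.mem_range.1 hj)]
    have h := congrArg (D R (Unitization R A)) (gam_mul_gam R m n a)
    rw [Derivation.leibniz, map_nsmul, ← heq, smul_add, choose_smul_conv R hxp hm a, hlt m hmN,
      hlt n (by omega)] at h
    exact left_eq_add.1 h

/-- The sequence with only d(ab), in degree 1, already has the right convolutions, by `conv_mul`. -/
theorem dlogγ_mul (a b : A) {n : ℕ} (hn : n ≠ 1) : dlogγ R (a * b) n = 0 := by
  refine (congrFun (dlogγ_eq_of_conv (x := fun j => if j = 1 then
    D R (Unitization R A) (Unitization.inr (a * b)) else 0) rfl fun n => ?_) n).trans (if_neg hn)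
  rw [conv_mul R (isPrimitiveSeq_dlogγ (R := R) b) rfl (fun j hj => if_neg hj.ne') a b
    (D R (Unitization R A) (Unitization.inr a)), conv_dlogγ, gam_mul, Derivation.leibniz,
    Derivation.leibniz_pow, Nat.add_sub_cancel, smul_comm _ (n + 1), smul_smul, mul_comm, smul_assoc]
  rw [if_pos rfl, Unitization.inr_mul, Derivation.leibniz, dlogγ_one]

theorem dlogγ_γ (a : A) {m n : ℕ} (hm : m ≠ 1) (hn : 0 < n) :
    dlogγ R (γ R n a) m = dlogγ R a (m * n) := by
  refine (congrFun (dlogγ_eq_of_conv (x := fun j => if j = 1 then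
    D R (Unitization R A) (gam R n a) else dlogγ R a (j * n)) ?_ fun n => ?_) m).trans (if_neg hm)
  · rw [if_neg zero_ne_one, zero_mul, dlogγ_zero]
  · rw [conv_gamma R (isPrimitiveSeq_dlogγ (R := R) a) hn a ((if_pos rfl).trans (conv_dlogγ _ _).symm)
      (fun l hl => if_neg hl), conv_dlogγ, gam_gam R _ hn, map_nsmul]

end Kaehler

/-! ### The Frobenius twist of p-torsion -/

section FrobTorsion

variable (R : Type u) (A : Type w) (M : Type v) [CommRing R] [NonUnitalCommRing A] [Module R A]
  [IsScalarTower R A A] [SMulCommClass R A A] [AddCommGroup M] [Module (Unitization R A) M]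
  (p : ℕ)

/-- The `p`-torsion of the `A₊`-module `M`, on which `r + a ∈ A₊` acts as `r ^ p`. -/
def FrobTorsion (_R : Type u) (_A : Type w) (M : Type v) [AddCommGroup M] (p : ℕ) : Type v :=
  (nsmulAddMonoidHom p : M →+ M).ker

namespace FrobTorsion

instance : AddCommGroup (FrobTorsion R A M p) :=
  inferInstanceAs (AddCommGroup (nsmulAddMonoidHom p : M →+ M).ker)

/-- The inclusion of the `p`-torsion. -/
def subtype : FrobTorsion R A M p →+ M := (nsmulAddMonoidHom p : M →+ M).ker.subtype

variable {M} in
/-- An element of the `p`-torsion. -/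
def of (w : M) (hw : p • w = 0) : FrobTorsion R A M p := ⟨w, hw⟩

variable {R A M p}

theorem subtype_of (w : M) (hw : p • w = 0) : subtype R A M p (of R A p w hw) = w := rfl

theorem nsmul_subtype (w : FrobTorsion R A M p) : p • subtype R A M p w = 0 := w.2

theorem subtype_injective : Function.Injective (subtype R A M p) := Subtype.val_injective

instance : SMul (Unitization R A) (FrobTorsion R A M p) :=
  ⟨fun x w => of R A p ((Unitization.inl (x.fst ^ p) : Unitization R A) • subtype R A M p w) <| by
    rw [smul_comm, nsmul_subtype, smul_zero]⟩

theorem subtype_smul (x : Unitization R A) (w : FrobTorsion R A M p) : subtype R A M p (x • w)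
    = (Unitization.inl (x.fst ^ p) : Unitization R A) • subtype R A M p w := rfl

instance [hp : Fact p.Prime] : Module (Unitization R A) (FrobTorsion R A M p) where
  one_smul w := subtype_injective <| by
    rw [subtype_smul, Unitization.fst_one, one_pow, Unitization.inl_one, one_smul]
  mul_smul x y w := subtype_injective <| by
    rw [subtype_smul, subtype_smul, subtype_smul, smul_smul, Unitization.fst_mul, mul_pow,
      Unitization.inl_mul]
  smul_zero x := subtype_injective <| by rw [subtype_smul, map_zero, smul_zero]
  smul_add x w w' := subtype_injective <| by
    rw [map_add, subtype_smul, subtype_smul, subtype_smul, map_add, smul_add]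
  add_smul x y w := subtype_injective <| by
    -- The difference of (r + s)^p and r^p + s^p is a multiple of p, which annihilates the torsion.
    rw [map_add, subtype_smul, subtype_smul, subtype_smul, Unitization.fst_add,
      add_pow_prime_eq hp.out, mul_assoc, mul_assoc, ← nsmul_eq_mul, Unitization.inl_add,
      Unitization.inl_add, add_smul, add_smul]
    convert add_zero _
    rw [← Unitization.algebraMap_eq_inl, map_nsmul, smul_assoc, smul_comm, nsmul_subtype, smul_zero]
  zero_smul w := subtype_injective <| by
    rw [subtype_smul, Unitization.fst_zero, zero_pow hp.out.ne_zero, Unitization.inl_zero, zero_smul,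
      map_zero]

instance [hp : Fact p.Prime] : Module R (FrobTorsion R A M p) :=
  Module.compHom _ (algebraMap R (Unitization R A))

instance [hp : Fact p.Prime] : IsScalarTower R (Unitization R A) (FrobTorsion R A M p) :=
  IsScalarTower.of_algebraMap_smul fun _ _ => rfl

theorem subtype_smul' [hp : Fact p.Prime] (r : R) (w : FrobTorsion R A M p) :
    subtype R A M p (r • w) = (Unitization.inl (r ^ p) : Unitization R A) • subtype R A M p w := by
  rw [← algebraMap_smul (Unitization R A) r w, subtype_smul, Unitization.algebraMap_eq_inl,
    Unitization.fst_inl]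

end FrobTorsion

end FrobTorsion

/-! ### The operations φ_p on Ω -/

section KaehlerAction

open DPAlgebra KaehlerDifferential

variable (R : Type u) (A : Type w) [CommRing R] [NonUnitalCommRing A] [Module R A]
  [IsScalarTower R A A] [SMulCommClass R A A] [DPAlgebra R A]

theorem nsmul_dlogγ_prime (p : ℕ) [hp : Fact p.Prime] (a : A) : p • dlogγ R a p = 0 := by
  rw [← (isPrimitiveSeq_dlogγ a).2 p 1 one_pos hp.out.one_lt, Nat.choose_one_right]

/-- The derivation `r + a ↦ φ_p(da)`, as a derivation with values in the twisted `p`-torsion. -/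
noncomputable def frobDerivation (p : ℕ) [hp : Fact p.Prime] :
    Derivation R (Unitization R A) (FrobTorsion R A (Ω[Unitization R A⁄R]) p) :=
  Derivation.mk'
    { toFun := fun x => .of R A p (dlogγ R x.snd p) (nsmul_dlogγ_prime R A p _)
      map_add' := fun x y => FrobTorsion.subtype_injective <| by
        rw [map_add]
        exact dlogγ_add _ _ _
      map_smul' := fun r x => FrobTorsion.subtype_injective <| by
        rw [FrobTorsion.subtype_smul']
        exact dlogγ_smul _ _ _ }
    fun x y => FrobTorsion.subtype_injective <| by
      rw [map_add, FrobTorsion.subtype_smul, FrobTorsion.subtype_smul]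
      simp only [LinearMap.coe_mk, AddHom.coe_mk, FrobTorsion.subtype_of]
      -- The A-component of (r + a)(s + b) is r b + s a + a b. Since ψ_p(ab) = 0, what is left is
      -- the Leibniz rule for the twisted action.
      rw [Unitization.snd_mul, dlogγ_add, dlogγ_add, dlogγ_mul _ _ hp.out.ne_one, add_zero]
      rw [dlogγ_smul, dlogγ_smul]

/-- The operation `φ_p` on the Kähler differentials of `A₊`. -/
noncomputable def kaehlerFrob (p : ℕ) [Fact p.Prime] :
    Ω[Unitization R A⁄R] →+ Ω[Unitization R A⁄R] :=
  (FrobTorsion.subtype R A _ p).comp (frobDerivation R A p).liftKaehlerDifferential.toAddMonoidHom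

variable {R A}

theorem kaehlerFrob_smul (p : ℕ) [Fact p.Prime] (x : Unitization R A)
    (w : Ω[Unitization R A⁄R]) : kaehlerFrob R A p (x • w)
      = (Unitization.inl (x.fst ^ p) : Unitization R A) • kaehlerFrob R A p w :=
  (congrArg (FrobTorsion.subtype R A _ p)
    ((frobDerivation R A p).liftKaehlerDifferential.map_smul x w)).trans (FrobTorsion.subtype_smul _ _)

theorem nsmul_kaehlerFrob (p : ℕ) [Fact p.Prime] (w : Ω[Unitization R A⁄R]) :
    p • kaehlerFrob R A p w = 0 := FrobTorsion.nsmul_subtype _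

theorem kaehlerFrob_D (p : ℕ) [Fact p.Prime] (x : Unitization R A) :
    kaehlerFrob R A p (D R (Unitization R A) x) = dlogγ R x.snd p :=
  congrArg (FrobTorsion.subtype R A _ p) (Derivation.liftKaehlerDifferential_comp_D _ _)

/-- `φ_p(ψ_n) = ψ_{p n}`, where `ψ_n` are the coefficients of the logarithmic derivative. -/
theorem kaehlerFrob_dlogγ (p : ℕ) [hp : Fact p.Prime] {n : ℕ} (hn : 0 < n) (a : A) :
    kaehlerFrob R A p (dlogγ R a n) = dlogγ R a (p * n) := by
  -- Write ψ_{pn}(a) = ψ_p(γ_n(a)) = φ_p(dγ_n(a)) and expand dγ_n(a) = Σ γ_{n-j}(a) ψ_j(a); φ_p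
  -- kills the terms with j < n.
  rw [← dlogγ_γ a hp.out.ne_one hn, ← Unitization.snd_inr R (γ R n a), ← kaehlerFrob_D,
    ← gam_of_pos R hn, ← conv_dlogγ, conv_eq_sum_range, Finset.sum_range_succ, map_add, map_sum,
    Finset.sum_eq_zero, zero_add, Nat.sub_self, gam_zero, one_smul]
  intro j hj
  rw [gam_of_pos R (Nat.sub_pos_of_lt (Finset.mem_range.1 hj)), kaehlerFrob_smul,
    Unitization.fst_inr, zero_pow hp.out.ne_zero, Unitization.inl_zero, zero_smul]

end KaehlerAction

/-! ### The operations `φ_n` -/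

namespace U0

variable (R : Type u) [CommRing R]

/-- Ring homomorphisms out of `U(0)`. -/
noncomputable def lift {B : Type*} [Ring B] (f : R →+* B) (g : Nat.Primes → B)
    (torsion : ∀ p : Nat.Primes, ((p : ℕ) : B) * g p = 0)
    (twist : ∀ (p : Nat.Primes) r, g p * f r = f (r ^ (p : ℕ)) * g p) :
    U0 R →+* B :=
  RingQuot.lift ⟨(FreeAlgebra.lift ℤ (Sum.elim f g) :
      FreeAlgebra ℤ (R ⊕ Nat.Primes) →ₐ[ℤ] B).toRingHom, by
    intro x y h
    induction h with
    | one => simp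
    | add r s => simp
    | mul r s => simp
    | torsion p =>
      have h := torsion p
      simpa using h
    | twist p r =>
      have h := twist p r
      rw [map_pow] at h
      simpa using h⟩

theorem lift_coeff {B : Type*} [Ring B] (f : R →+* B) (g : Nat.Primes → B)
    (torsion : ∀ p : Nat.Primes, ((p : ℕ) : B) * g p = 0)
    (twist : ∀ (p : Nat.Primes) r, g p * f r = f (r ^ (p : ℕ)) * g p) (r : R) :
    lift R f g torsion twist (coeff R r) = f r := by
  change RingQuot.lift _ (RingQuot.mkRingHom _ _) = _
  rw [RingQuot.lift_mkRingHom_apply]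
  simp

theorem lift_φ {B : Type*} [Ring B] (f : R →+* B) (g : Nat.Primes → B)
    (torsion : ∀ p : Nat.Primes, ((p : ℕ) : B) * g p = 0)
    (twist : ∀ (p : Nat.Primes) r, g p * f r = f (r ^ (p : ℕ)) * g p)
    (p : Nat.Primes) : lift R f g torsion twist (φ R p) = g p := by
  change RingQuot.lift _ (RingQuot.mkRingHom _ _) = _
  rw [RingQuot.lift_mkRingHom_apply]
  simp

/-- `U(0)` is generated by `R` and the `φ_p`. -/
theorem induction {P : U0 R → Prop} (coeff : ∀ r, P (coeff R r)) (φ : ∀ p, P (φ R p))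
    (add : ∀ u v, P u → P v → P (u + v)) (mul : ∀ u v, P u → P v → P (u * v)) (u : U0 R) :
    P u := by
  obtain ⟨x, rfl⟩ := RingQuot.mkRingHom_surjective (Rel R) u
  change P (mk R x)
  induction x using FreeAlgebra.induction with
  | grade0 n =>
    have h := coeff n
    rwa [map_intCast, ← map_intCast (mk R), ← eq_intCast (algebraMap ℤ (FreeAlgebra ℤ (R ⊕ Nat.Primes)))] at h
  | grade1 x =>
    rcases x with r | p
    · exact coeff r
    · exact φ p
  | mul x y hx hy =>
    rw [map_mul]
    exact mul _ _ hx hy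
  | add x y hx hy =>
    rw [map_add]
    exact add _ _ hx hy

theorem nsmul_φ (p : Nat.Primes) : (p : ℕ) • φ R p = 0 := by
  have h := mk_rel (Rel.torsion (R := R) p)
  rwa [map_nsmul, map_zero] at h

theorem φ_mul_coeff (p : Nat.Primes) (r : R) :
    φ R p * coeff R r = coeff R (r ^ (p : ℕ)) * φ R p := by
  have h := mk_rel (Rel.twist p r)
  rwa [map_mul, map_mul] at h

/-- The product is killed by p, and also by q^p because q^p φ_p φ_q = φ_p q φ_q = 0. These integers
are coprime. -/
theorem φ_mul_φ {p q : Nat.Primes} (hpq : p ≠ q) : φ R p * φ R q = 0 := by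
  have h1 : (p : ℕ) • (φ R p * φ R q) = 0 := by rw [← smul_mul_assoc, nsmul_φ, zero_mul]
  have h2 : ((q : ℕ) ^ (p : ℕ)) • (φ R p * φ R q) = 0 := by
    have h := φ_mul_coeff R p ((q : ℕ) : R)
    rw [← Nat.cast_pow, map_natCast, map_natCast] at h
    rw [nsmul_eq_mul, ← mul_assoc, ← h, mul_assoc, ← nsmul_eq_mul, nsmul_φ, mul_zero]
  have hc : Nat.Coprime p (q ^ (p : ℕ)) :=
    ((Nat.coprime_primes p.2 q.2).2 fun h => hpq (Subtype.ext h)).pow_right _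
  have h3 := Nat.dvd_gcd (addOrderOf_dvd_of_nsmul_eq_zero h1) (addOrderOf_dvd_of_nsmul_eq_zero h2)
  rw [hc.gcd_eq_one, Nat.dvd_one, AddMonoid.addOrderOf_eq_one_iff] at h3
  exact h3

theorem phi_one : phi R 1 = 1 := if_pos rfl

theorem phi_of_not_isPrimePow {n : ℕ} (h1 : n ≠ 1) (h : ¬ IsPrimePow n) : phi R n = 0 := by
  rw [phi, if_neg h1, dif_neg h]

theorem phi_zero : phi R 0 = 0 := phi_of_not_isPrimePow R zero_ne_one not_isPrimePow_zero

/-- The case distinction in the definition of `φ_n`. -/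
theorem phi_cases (n : ℕ) : n = 1 ∨ (∃ (p : Nat.Primes) (e : ℕ), n = (p : ℕ) ^ (e + 1)) ∨
    (n ≠ 1 ∧ ¬ IsPrimePow n ∧ phi R n = 0) := by
  by_cases h1 : n = 1
  · exact .inl h1
  by_cases h : IsPrimePow n
  · obtain ⟨p, e, hp, he, rfl⟩ := (isPrimePow_nat_iff n).1 h
    exact .inr (.inl ⟨⟨p, hp⟩, e - 1, by rw [Nat.sub_add_cancel he]⟩)
  · exact .inr (.inr ⟨h1, h, phi_of_not_isPrimePow R h1 h⟩)

/-- This multiplicativity makes the convention φ_n = 0 off prime powers consistent: for powers of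
distinct primes, both sides vanish. -/
theorem phi_mul_phi (m n : ℕ) : phi R m * phi R n = phi R (m * n) := by
  rcases phi_cases R m with rfl | ⟨p, d, rfl⟩ | ⟨hm1, hm, h⟩
  · rw [phi_one, one_mul, one_mul]
  · rcases phi_cases R n with rfl | ⟨q, e, rfl⟩ | ⟨hn1, hn, h⟩
    · rw [phi_one, mul_one, mul_one]
    · by_cases hpq : p = q
      · subst hpq
        rw [← pow_add, phi_prime_pow, phi_prime_pow, phi_prime_pow, ← pow_add]
      · rw [phi_prime_pow, phi_prime_pow, pow_succ, pow_succ', mul_assoc,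
          ← mul_assoc (φ R p) (φ R q), φ_mul_φ R hpq, zero_mul, mul_zero,
          phi_of_not_isPrimePow]
        · exact fun h => (Nat.one_lt_pow (Nat.succ_ne_zero d) p.2.one_lt).ne'
            (Nat.eq_one_of_mul_eq_one_right h)
        · intro h
          obtain ⟨r, k, hr, -, hk⟩ := (isPrimePow_nat_iff _).1 h
          have h1 : (p : ℕ) ∣ r ^ k := hk ▸ Dvd.dvd.mul_right (dvd_pow_self _ (by omega)) _
          have h2 : (q : ℕ) ∣ r ^ k := hk ▸ Dvd.dvd.mul_left (dvd_pow_self _ (by omega)) _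
          exact hpq (Subtype.ext (((Nat.prime_dvd_prime_iff_eq p.2 hr).1
            (p.2.dvd_of_dvd_pow h1)).trans ((Nat.prime_dvd_prime_iff_eq q.2 hr).1
            (q.2.dvd_of_dvd_pow h2)).symm))
    · rw [h, mul_zero, phi_of_not_isPrimePow]
      · exact fun h' => hn1 (Nat.eq_one_of_mul_eq_one_left h')
      · exact fun h' => hn (h'.dvd (Nat.dvd_mul_left _ _) hn1)
  · rw [h, zero_mul, phi_of_not_isPrimePow]
    · exact fun h' => hm1 (Nat.eq_one_of_mul_eq_one_right h')
    · exact fun h' => hm (h'.dvd (Nat.dvd_mul_right _ _) hm1)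

theorem φ_pow_mul_coeff (p : Nat.Primes) (e : ℕ) (r : R) :
    φ R p ^ e * coeff R r = coeff R (r ^ ((p : ℕ) ^ e)) * φ R p ^ e := by
  induction e generalizing r with
  | zero => simp
  | succ e ih =>
    rw [pow_succ, mul_assoc, φ_mul_coeff, ← mul_assoc, ih, mul_assoc, ← pow_mul, ← pow_succ']

theorem phi_mul_coeff (n : ℕ) (r : R) : phi R n * coeff R r = coeff R (r ^ n) * phi R n := by
  rcases phi_cases R n with rfl | ⟨p, e, rfl⟩ | ⟨-, -, h⟩
  · rw [phi_one, one_mul, mul_one, pow_one]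
  · rw [phi_prime_pow, φ_pow_mul_coeff]
  · rw [h, zero_mul, mul_zero]

theorem isPrimitiveSeq_phi : IsPrimitiveSeq (phi R) :=
  isPrimitiveSeq_of_isPrimePow (phi_zero R)
    (fun _ hn h => phi_of_not_isPrimePow R hn.ne' h) fun p e hp he => by
    obtain ⟨e, rfl⟩ := Nat.exists_eq_add_of_lt he
    rw [Nat.zero_add]
    rw [phi_prime_pow R ⟨p, hp⟩, pow_succ', ← smul_mul_assoc]
    exact mul_eq_zero_of_left (nsmul_φ R ⟨p, hp⟩) _

end U0

/-! ### The operations φ_n on U(A)-modules -/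

namespace UEnv

variable {R : Type u} {A : Type w} [CommRing R] [NonUnitalCommRing A] [Module R A]
  [IsScalarTower R A A] [SMulCommClass R A A]

theorem ofU0_coeff (r : R) :
    ofU0 R A (U0.coeff R r) = ofUnitization R A (Unitization.inl r) := by
  change tmul R A 1 (U0.coeff R r) = tmul R A (Unitization.inl r) 1
  rw [← mul_one (U0.coeff R r), tmul_coeff_mul, ← Unitization.algebraMap_eq_inl,
    Algebra.algebraMap_eq_smul_one]

theorem phi_mul_inr {n : ℕ} (hn : 1 < n) (a : A) :
    ofU0 R A (U0.phi R n) * ofUnitization R A (a : Unitization R A) = 0 := by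
  rcases U0.phi_cases R n with rfl | ⟨p, e, rfl⟩ | ⟨-, -, h⟩
  · omega
  · rw [U0.phi_prime_pow, pow_succ, map_mul, mul_assoc, φ_mul_inr, mul_zero]
  · rw [h, map_zero, zero_mul]

/-- The operations `φ_n` of a `U(A)`-module. -/
noncomputable def phiAction (M : Type v) [AddCommGroup M] [Module (Unitization R A) M]
    [Module (UEnv R A) M] (h : ∀ (x : Unitization R A) (w : M), ofUnitization R A x • w = x • w) :
    PhiAction R A M where
  φ n := DistribSMul.toAddMonoidHom M (ofU0 R A (U0.phi R n))
  one w := by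
    rw [DistribSMul.toAddMonoidHom_apply, U0.phi_one, map_one, one_smul]
  primitive w := by
    refine ⟨?_, fun n i hi hin => ?_⟩ <;> simp only [DistribSMul.toAddMonoidHom_apply]
    · rw [U0.phi_zero, map_zero, zero_smul]
    · rw [← smul_assoc, ← map_nsmul, (U0.isPrimitiveSeq_phi R).2 n i hi hin, map_zero, zero_smul]
  mul m n w := by
    simp only [DistribSMul.toAddMonoidHom_apply]
    rw [smul_smul, ← map_mul, U0.phi_mul_phi]
  smul_inl n r w := by
    simp only [DistribSMul.toAddMonoidHom_apply]
    rw [← h, ← h, ← ofU0_coeff, ← ofU0_coeff, smul_smul, smul_smul, ← map_mul, ← map_mul,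
      U0.phi_mul_coeff]
  smul_inr n a w hn := by
    simp only [DistribSMul.toAddMonoidHom_apply]
    rw [← h, smul_smul, phi_mul_inr hn, zero_smul]

theorem ofUnitization_smul_tensor {V : Type v} [AddCommGroup V] [Module R V]
    (x : Unitization R A) (w : UEnv R A ⊗[R] V) : ofUnitization R A x • w = x • w := by
  induction w using TensorProduct.induction_on with
  | zero => rw [smul_zero, smul_zero]
  | tmul y v => rw [TensorProduct.smul_tmul', TensorProduct.smul_tmul', smul_eq_mul,
      ofUnitization_mul]
  | add w w' h h' => rw [smul_add, smul_add, h, h']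

end UEnv

/-! ### The U(0)-action on Ω and the extension of derivations -/

section KaehlerModule

open DPAlgebra KaehlerDifferential

variable (R : Type u) (A : Type w) [CommRing R] [NonUnitalCommRing A] [Module R A]
  [IsScalarTower R A A] [SMulCommClass R A A] [DPAlgebra R A]

/-- The operation `φ_p` on the Kähler differentials, as an additive endomorphism. -/
noncomputable def kaehlerφ (p : Nat.Primes) : AddMonoid.End (Ω[Unitization R A⁄R]) :=
  haveI : Fact (p : ℕ).Prime := ⟨p.2⟩
  kaehlerFrob R A (p : ℕ)

/-- The action of `U(0)` on the Kähler differentials of `A₊`. -/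
noncomputable def kaehlerAct : U0 R →+* AddMonoid.End (Ω[Unitization R A⁄R]) :=
  U0.lift R ((Module.toAddMonoidEnd (Unitization R A) _).comp (Unitization.inlRingHom R A))
    (kaehlerφ R A)
    (fun p => DFunLike.ext _ _ fun w => by
      have : Fact (p : ℕ).Prime := ⟨p.2⟩
      rw [AddMonoid.End.coe_mul, Function.comp_apply, AddMonoid.End.natCast_apply]
      exact nsmul_kaehlerFrob (p : ℕ) w)
    (fun p r => DFunLike.ext _ _ fun w => by
      have : Fact (p : ℕ).Prime := ⟨p.2⟩
      rw [AddMonoid.End.coe_mul, AddMonoid.End.coe_mul]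
      exact kaehlerFrob_smul (p : ℕ) (Unitization.inl r) w)

variable {R A}

theorem kaehlerAct_coeff (r : R) (w : Ω[Unitization R A⁄R]) :
    kaehlerAct R A (U0.coeff R r) w = (Unitization.inl r : Unitization R A) • w :=
  DFunLike.congr_fun (U0.lift_coeff R _ _ _ _ r) w

theorem kaehlerAct_φ (p : Nat.Primes) [Fact (p : ℕ).Prime] (w : Ω[Unitization R A⁄R]) :
    kaehlerAct R A (U0.φ R p) w = kaehlerFrob R A p w :=
  DFunLike.congr_fun (U0.lift_φ R _ _ _ _ p) w

/-- Prime powers follow by iterating φ_p ψ_n = ψ_{pn}; for other n > 1, primitivity forces ψ_n(a) =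
0. -/
theorem kaehlerAct_phi (n : ℕ) (a : A) :
    kaehlerAct R A (U0.phi R n) (D R (Unitization R A) (Unitization.inr a)) = dlogγ R a n := by
  have hpow : ∀ (p : Nat.Primes) (e : ℕ), kaehlerAct R A (U0.phi R ((p : ℕ) ^ e))
      (D R (Unitization R A) (Unitization.inr a)) = dlogγ R a ((p : ℕ) ^ e) := fun p e => by
    have : Fact (p : ℕ).Prime := ⟨p.2⟩
    induction e with
    | zero => rw [pow_zero, U0.phi_one, map_one, dlogγ_one]; rfl
    | succ e ih =>
      rw [U0.phi_prime_pow] at ih ⊢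
      rw [pow_succ', map_mul, AddMonoid.End.coe_mul, Function.comp_apply, ih, kaehlerAct_φ,
        kaehlerFrob_dlogγ _ (pow_pos p.2.pos _), pow_succ']
  rcases U0.phi_cases R n with rfl | ⟨p, e, rfl⟩ | ⟨h1, hn, h⟩
  · exact hpow ⟨2, Nat.prime_two⟩ 0
  · exact hpow p _
  · rw [h, map_zero, AddMonoid.End.zero_apply]
    rcases Nat.eq_zero_or_pos n with rfl | h0
    · rw [dlogγ_zero]
    -- Comparing the coefficients 1 and 0 is legitimate because n is not a prime power, so no
    -- congruence has to be checked.
    · rw [← one_smul ℕ (dlogγ R a n), (isPrimitiveSeq_dlogγ (R := R) a).nsmul_eq (d := 0) (by omega),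
        zero_smul]
      intro p f hp hf
      refine absurd ?_ hn
      rw [hf]
      refine hp.out.isPrimePow.pow ?_
      rintro rfl
      exact h1 (by rw [hf, pow_zero])

/-- A derivation of the non-unital algebra `A` with values in an `A₊`-module extends to the
Kähler differentials of `A₊`. -/
theorem exists_kaehler_lift {M : Type*} [AddCommGroup M] [Module (Unitization R A) M]
    (d : A →+ M) (hsmul : ∀ (r : R) a, d (r • a) = (Unitization.inl r : Unitization R A) • d a)
    (hmul : ∀ a b, d (a * b) = (Unitization.inr a : Unitization R A) • d b
      + (Unitization.inr b : Unitization R A) • d a) :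
    ∃ L : Ω[Unitization R A⁄R] →ₗ[Unitization R A] M,
      ∀ a, L (D R (Unitization R A) (Unitization.inr a)) = d a := by
  -- R must act through A₊. On U(A) ⊗ V this is left multiplication, not the R-structure of the
  -- tensor product, which comes from right multiplication.
  let _ : Module R M := Module.compHom M (algebraMap R (Unitization R A))
  have _ : IsScalarTower R (Unitization R A) M := IsScalarTower.of_algebraMap_smul fun _ _ => rfl
  let δ : Derivation R (Unitization R A) M := Derivation.mk'
    { toFun := fun x => d x.snd
      map_add' := fun x y => map_add d _ _
      map_smul' := fun r x => hsmul r x.snd }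
    fun x y => by
      change d (x * y).snd = x • d y.snd + y • d x.snd
      have h : ∀ (z : Unitization R A) (w : M), z • w = (Unitization.inl z.fst : Unitization R A) • w
          + (Unitization.inr z.snd : Unitization R A) • w := fun z w => by
        rw [← add_smul, Unitization.inl_fst_add_inr_snd_eq]
      rw [Unitization.snd_mul, map_add, map_add, hsmul, hsmul, hmul, h x, h y]
      abel
  exact ⟨δ.liftKaehlerDifferential, fun a => δ.liftKaehlerDifferential_comp_D _⟩

end KaehlerModule

/-! ### Kähler differentials of the free divided power algebra -/

section PhiActionLemmas

open DPAlgebra KaehlerDifferential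

variable {R : Type u} {A : Type w} {M : Type v} [CommRing R] [NonUnitalCommRing A] [Module R A]
  [IsScalarTower R A A] [SMulCommClass R A A] [AddCommGroup M] [Module (Unitization R A) M]

theorem PhiAction.smul (Φ : PhiAction R A M) {n : ℕ} (hn : 1 < n) (x : Unitization R A) (w : M) :
    Φ.φ n (x • w) = (Unitization.inl (x.fst ^ n) : Unitization R A) • Φ.φ n w := by
  conv_lhs => rw [← Unitization.inl_fst_add_inr_snd_eq x]
  rw [add_smul, map_add, Φ.smul_inl, Φ.smul_inr _ _ _ hn, add_zero]

variable [DPAlgebra R A]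

/-- Both sequences have the same convolutions with the divided powers of a, namely L(dγ_n(a)), and
convolution is injective. -/
theorem map_dlogγ (Φ : PhiAction R A M) (L : Ω[Unitization R A⁄R] →ₗ[Unitization R A] M)
    (hL : ∀ n, 0 < n → ∀ a, L (D R (Unitization R A) (Unitization.inr (γ R n a)))
      = conv R n a fun j => Φ.φ j (L (D R (Unitization R A) (Unitization.inr a))))
    (n : ℕ) (a : A) :
    L (dlogγ R a n) = Φ.φ n (L (D R (Unitization R A) (Unitization.inr a))) := by
  refine congrFun (conv_injective R (x := fun n => L (dlogγ R a n))
    (y := fun n => Φ.φ n (L (D R (Unitization R A) (Unitization.inr a)))) a fun n => ?_) n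
  rcases Nat.eq_zero_or_pos n with rfl | hn
  · rw [conv_zero R a (by rw [dlogγ_zero, map_zero]), conv_zero R a (Φ.primitive _).1]
  · rw [← map_conv, conv_dlogγ, gam_of_pos R hn, hL n hn]

theorem D_eq_D_inr_snd (x : Unitization R A) :
    D R (Unitization R A) x = D R (Unitization R A) (Unitization.inr x.snd) := by
  conv_lhs => rw [← Unitization.inl_fst_add_inr_snd_eq x]
  rw [map_add, ← Unitization.algebraMap_eq_inl, Derivation.map_algebraMap, zero_add]

/-- Both sides are semilinear along r + a ↦ r^p, so it suffices to compare them on exact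
differentials, which span Ω. -/
theorem map_kaehlerFrob (Φ : PhiAction R A M) (L : Ω[Unitization R A⁄R] →ₗ[Unitization R A] M)
    (hL : ∀ n, 0 < n → ∀ a, L (D R (Unitization R A) (Unitization.inr (γ R n a)))
      = conv R n a fun j => Φ.φ j (L (D R (Unitization R A) (Unitization.inr a))))
    (p : ℕ) [hp : Fact p.Prime] (w : Ω[Unitization R A⁄R]) :
    L (kaehlerFrob R A p w) = Φ.φ p (L w) := by
  have hw : w ∈ Submodule.span (Unitization R A) (Set.range (D R (Unitization R A))) := by
    rw [span_range_derivation]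
    trivial
  induction hw using Submodule.span_induction with
  | mem x h =>
    obtain ⟨y, rfl⟩ := h
    rw [kaehlerFrob_D, map_dlogγ Φ L hL, ← D_eq_D_inr_snd]
  | zero => simp only [map_zero]
  | add x y _ _ hx hy => simp only [map_add, hx, hy]
  | smul x w _ hw => rw [kaehlerFrob_smul, map_smul, map_smul, hw, Φ.smul hp.out.one_lt]

end PhiActionLemmas

/-! ### The derivation and the inverse map for Γ_R(V) -/

namespace FreeDP

open DPAlgebra KaehlerDifferential

variable {R : Type u} {V : Type v} [CommRing R] [AddCommGroup V] [Module R V]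

/-- Divided power derivations of the free divided power algebra `Γ_R(V)` are determined by
arbitrary `R`-linear maps on `V`. -/
theorem exists_derivation {M : Type w} [AddCommGroup M] [Module (Unitization R (FreeDP R V)) M]
    (Φ : PhiAction R (FreeDP R V) M) (f : V →+ M)
    (hf : ∀ (r : R) x, f (r • x) = (Unitization.inl r : Unitization R (FreeDP R V)) • f x) :
    ∃ d : FreeDP R V →+ M,
      (∀ (r : R) a, d (r • a) = (Unitization.inl r : Unitization R (FreeDP R V)) • d a) ∧
      (∀ a b, d (a * b) = (Unitization.inr a : Unitization R (FreeDP R V)) • d b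
        + (Unitization.inr b : Unitization R (FreeDP R V)) • d a) ∧
      (∀ x, d (ι R V x) = f x) ∧
      ∀ n a, d (γ R n a) = conv R n a fun j => Φ.φ j (d a) := by
  let _ : DPAlgebra R (SqZeroExt R (FreeDP R V) M) := SqZeroExt.dpAlgebra Φ
  let F : V →ₗ[R] SqZeroExt R (FreeDP R V) M :=
    { toFun := fun x => ⟨ι R V x, f x⟩
      map_add' := fun x y => SqZeroExt.ext (map_add _ _ _) (map_add _ _ _)
      map_smul' := fun r x => SqZeroExt.ext (map_smul _ _ _) (hf r x) }
  obtain ⟨g, ⟨hγ, hι⟩, -⟩ := existsUnique_lift F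
  let π : SqZeroExt R (FreeDP R V) M →ₙₐ[R] FreeDP R V :=
    { toFun := SqZeroExt.fst
      map_smul' := fun _ _ => rfl
      map_zero' := rfl
      map_add' := fun _ _ => rfl
      map_mul' := fun _ _ => rfl }
  -- The composite and the identity are DP endomorphisms fixing V, so uniqueness makes g a section
  -- of the projection.
  have hπ : π.comp g = NonUnitalAlgHom.id R (FreeDP R V) :=
    (existsUnique_lift (ι R V)).unique
      ⟨fun n a => congrArg SqZeroExt.fst (hγ n a), fun x => congrArg SqZeroExt.fst (hι x)⟩
      ⟨fun _ _ => rfl, fun _ => rfl⟩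
  have hfst : ∀ a, (g a).fst = a := fun a => DFunLike.congr_fun hπ a
  refine ⟨AddMonoidHom.mk' (fun a => (g a).snd) fun a b =>
    congrArg SqZeroExt.snd (map_add g a b), fun r a => ?_, fun a b => ?_,
    fun x => congrArg SqZeroExt.snd (hι x), fun n a => ?_⟩
  · exact congrArg SqZeroExt.snd (map_smul g r a)
  · refine (congrArg SqZeroExt.snd (map_mul g a b)).trans ?_
    rw [SqZeroExt.snd_mul, hfst, hfst]
    rfl
  · refine (congrArg SqZeroExt.snd (hγ n a)).trans ?_
    change conv R n (g a).fst (fun j => Φ.φ j (g a).snd) = _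
    rw [hfst]
    rfl

variable (R V)

/-- Left and right multiplication by R agree on 1 ∈ U(A), so v ↦ 1 ⊗ v is linear for the left action
although the tensor product uses the right one. -/
theorem inl_smul_one_tmul (r : R) (x : V) :
    (1 : UEnv R (FreeDP R V)) ⊗ₜ[R] (r • x)
      = (Unitization.inl r : Unitization R (FreeDP R V)) • ((1 : UEnv R (FreeDP R V)) ⊗ₜ[R] x) := by
  rw [← TensorProduct.smul_tmul, TensorProduct.smul_tmul', UEnv.right_smul_def, one_mul,
    UEnv.ofU0_coeff, ← UEnv.ofUnitization_mul, mul_one]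

/-- The map `V → Ω`, `x ↦ dx`. -/
noncomputable def dι : V →+ Ω[Unitization R (FreeDP R V)⁄R] :=
  (D R (Unitization R (FreeDP R V))).toLinearMap.toAddMonoidHom.comp
    ((Unitization.inrHom R R (FreeDP R V)).toAddMonoidHom.comp (ι R V).toAddMonoidHom)

theorem dι_apply (x : V) :
    dι R V x = D R (Unitization R (FreeDP R V)) (Unitization.inr (ι R V x)) := rfl

theorem dι_smul (r : R) (x : V) : dι R V (r • x)
    = (Unitization.inl r : Unitization R (FreeDP R V)) • dι R V x := by
  rw [dι_apply, map_smul, Unitization.inr_smul, Derivation.map_smul, ← dι_apply,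
    ← Unitization.algebraMap_eq_inl, algebraMap_smul]

/-- The biadditive map `(x ⊗ u, v) ↦ x u dv`. -/
noncomputable def toKaehlerAux :
    UEnv R (FreeDP R V) →+ V →+ Ω[Unitization R (FreeDP R V)⁄R] :=
  UEnv.liftAdd
    (AddMonoidHom.mk' (fun x => AddMonoidHom.mk' (fun u =>
        (DistribSMul.toAddMonoidHom _ x).comp
          (AddMonoidHom.comp (kaehlerAct R (FreeDP R V) u) (dι R V)))
        (fun u u' => by
          ext v
          change x • kaehlerAct R _ (u + u') (dι R V v) = x • kaehlerAct R _ u (dι R V v)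
            + x • kaehlerAct R _ u' (dι R V v)
          rw [map_add, ← smul_add]
          rfl))
      (fun x x' => by
        ext u v
        exact add_smul x x' _))
    (fun r x u => by
      ext v
      change (r • x) • kaehlerAct R _ u (dι R V v)
        = x • kaehlerAct R _ (U0.coeff R r * u) (dι R V v)
      rw [map_mul, AddMonoid.End.coe_mul, Function.comp_apply, kaehlerAct_coeff, smul_smul,
        mul_comm, ← Unitization.algebraMap_eq_inl, Algebra.smul_def])

theorem toKaehlerAux_tmul (x : Unitization R (FreeDP R V)) (u : U0 R) (v : V) :
    toKaehlerAux R V (UEnv.tmul R _ x u) v = x • kaehlerAct R _ u (dι R V v) := rfl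

/-- Balancedness over the right R-structure: x (u r) dv = x u d(rv). -/
theorem toKaehlerAux_right_smul (r : R) (w : UEnv R (FreeDP R V)) (v : V) :
    toKaehlerAux R V (r • w) v = toKaehlerAux R V w (r • v) := by
  induction w using UEnv.induction with
  | zero => rw [smul_zero, map_zero, AddMonoidHom.zero_apply, AddMonoidHom.zero_apply]
  | tmul x u =>
    rw [UEnv.right_smul_def, ← UEnv.ofUnitization_mul_ofU0, mul_assoc, ← map_mul,
      UEnv.ofUnitization_mul_ofU0, UEnv.ofUnitization_mul_ofU0, toKaehlerAux_tmul,
      toKaehlerAux_tmul, map_mul, AddMonoid.End.coe_mul, Function.comp_apply,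
      kaehlerAct_coeff, dι_smul]
  | add w w' h h' => rw [smul_add, map_add, map_add, AddMonoidHom.add_apply,
      AddMonoidHom.add_apply, h, h']

theorem toKaehlerAux_smul (x : Unitization R (FreeDP R V)) (w : UEnv R (FreeDP R V)) (v : V) :
    toKaehlerAux R V (x • w) v = x • toKaehlerAux R V w v := by
  induction w using UEnv.induction with
  | zero => rw [smul_zero, map_zero, AddMonoidHom.zero_apply, smul_zero]
  | tmul y u => rw [UEnv.smul_tmul, toKaehlerAux_tmul, toKaehlerAux_tmul, mul_smul]
  | add w w' h h' => rw [smul_add, map_add, map_add, AddMonoidHom.add_apply,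
      AddMonoidHom.add_apply, h, h', smul_add]

/-- The map `U(A) ⊗ V → Ω`, `(x ⊗ u) ⊗ v ↦ x u dv`, for `A = Γ_R(V)`, as an additive map. -/
noncomputable def toKaehlerAddHom :
    UEnv R (FreeDP R V) ⊗[R] V →+ Ω[Unitization R (FreeDP R V)⁄R] :=
  TensorProduct.liftAddHom (toKaehlerAux R V) (toKaehlerAux_right_smul R V)

theorem toKaehlerAddHom_tmul (w : UEnv R (FreeDP R V)) (v : V) :
    toKaehlerAddHom R V (w ⊗ₜ v) = toKaehlerAux R V w v := rfl

theorem toKaehlerAddHom_smul (x : Unitization R (FreeDP R V)) (w : UEnv R (FreeDP R V) ⊗[R] V) :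
    toKaehlerAddHom R V (x • w) = x • toKaehlerAddHom R V w := by
  induction w using TensorProduct.induction_on with
  | zero => rw [smul_zero, map_zero, smul_zero]
  | tmul w v =>
    rw [TensorProduct.smul_tmul', toKaehlerAddHom_tmul, toKaehlerAddHom_tmul, toKaehlerAux_smul]
  | add w w' h h' => rw [smul_add, map_add, map_add, smul_add, h, h']

/-- The map `U(A) ⊗ V → Ω`, `(x ⊗ u) ⊗ v ↦ x u dv`, for `A = Γ_R(V)`. -/
noncomputable def toKaehler : (UEnv R (FreeDP R V) ⊗[R] V) →ₗ[Unitization R (FreeDP R V)]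
    Ω[Unitization R (FreeDP R V)⁄R] :=
  { toKaehlerAddHom R V with map_smul' := toKaehlerAddHom_smul R V }

theorem toKaehler_tmul (x : Unitization R (FreeDP R V)) (u : U0 R) (v : V) :
    toKaehler R V (UEnv.tmul R _ x u ⊗ₜ[R] v) = x • kaehlerAct R _ u (dι R V v) := rfl

variable {R V} in
-- The image is stable because φ_p moves past x ∈ A₊ as the p-th power of its R-component, and then
-- multiplies u.
theorem kaehlerAct_mem_range (u : U0 R) {w : Ω[Unitization R (FreeDP R V)⁄R]}
    (hw : w ∈ LinearMap.range (toKaehler R V)) :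
    kaehlerAct R _ u w ∈ LinearMap.range (toKaehler R V) := by
  induction u using U0.induction generalizing w with
  | coeff r =>
    rw [kaehlerAct_coeff]
    exact Submodule.smul_mem _ _ hw
  | φ p =>
    have : Fact (p : ℕ).Prime := ⟨p.2⟩
    obtain ⟨z, rfl⟩ := hw
    induction z using TensorProduct.induction_on with
    | zero => simp only [map_zero, Submodule.zero_mem]
    | tmul z v =>
      induction z using UEnv.induction with
      | zero => simp only [TensorProduct.zero_tmul, map_zero, Submodule.zero_mem]
      | tmul x u =>
        rw [toKaehler_tmul, kaehlerAct_φ, kaehlerFrob_smul, ← kaehlerAct_φ]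
        refine Submodule.smul_mem _ _ ⟨UEnv.tmul R _ 1 (U0.φ R p * u) ⊗ₜ v, ?_⟩
        rw [toKaehler_tmul, one_smul, map_mul]
        rfl
      | add z z' h h' =>
        rw [TensorProduct.add_tmul, map_add, map_add]
        exact Submodule.add_mem _ h h'
    | add z z' h h' =>
      rw [map_add, map_add]
      exact Submodule.add_mem _ h h'
  | add u v hu hv =>
    rw [map_add]
    exact Submodule.add_mem _ (hu hw) (hv hw)
  | mul u v hu hv =>
    rw [map_mul]
    exact hu (hv hw)

/-- By induction on formal expressions. The step for γ_n uses dγ_n(a) = Σ γ_j(a) φ_i(da) and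
stability of the image under U(0). -/
theorem D_inr_mem_range (a : FreeDP R V) :
    D R (Unitization R (FreeDP R V)) (Unitization.inr a) ∈ LinearMap.range (toKaehler R V) := by
  refine ind (fun t => ?_) a
  induction t with
  | of x =>
    refine ⟨1 ⊗ₜ x, ?_⟩
    change toKaehler R V (UEnv.tmul R _ 1 1 ⊗ₜ x) = _
    rw [toKaehler_tmul, one_smul, map_one]
    rfl
  | zero =>
    rw [mk_zero, Unitization.inr_zero, map_zero]
    exact Submodule.zero_mem _
  | add s t hs ht =>
    rw [mk_add, Unitization.inr_add, map_add]
    exact Submodule.add_mem _ hs ht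
  | neg t ht =>
    rw [mk_neg, Unitization.inr_neg, map_neg]
    exact Submodule.neg_mem _ ht
  | smul r t ht =>
    rw [mk_smul, Unitization.inr_smul, Derivation.map_smul,
      ← algebraMap_smul (Unitization R (FreeDP R V)) r]
    exact Submodule.smul_mem _ _ ht
  | mul s t hs ht =>
    rw [mk_mul, Unitization.inr_mul, Derivation.leibniz]
    exact Submodule.add_mem _ (Submodule.smul_mem _ _ ht) (Submodule.smul_mem _ _ hs)
  | γ n t ht =>
    rw [mk_γ]
    change D R _ (Unitization.inr (γ R n (mk t))) ∈ _
    rcases Nat.eq_zero_or_pos n with rfl | hn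
    · rw [γ_zero, Unitization.inr_zero, map_zero]
      exact Submodule.zero_mem _
    · rw [← gam_of_pos R hn, ← conv_dlogγ]
      refine Submodule.sum_mem _ fun ij _ => Submodule.smul_mem _ _ ?_
      rw [← kaehlerAct_phi]
      exact kaehlerAct_mem_range _ ht

theorem toKaehler_surjective : Function.Surjective (toKaehler R V) := by
  rw [← LinearMap.range_eq_top, eq_top_iff, ← span_range_derivation, Submodule.span_le]
  rintro _ ⟨x, rfl⟩
  rw [SetLike.mem_coe, D_eq_D_inr_snd]
  exact D_inr_mem_range R V _

end FreeDP

open DPAlgebra in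
-- A map turning dγ_n(a) into the prescribed convolution is automatically U(0)-linear; this is
-- checked on the generators r and φ_p.
theorem map_kaehlerAct {R : Type u} {A : Type w} {M : Type v} [CommRing R] [NonUnitalCommRing A]
    [Module R A] [IsScalarTower R A A] [SMulCommClass R A A] [DPAlgebra R A] [AddCommGroup M]
    [Module (Unitization R A) M] [Module (UEnv R A) M]
    (h : ∀ (x : Unitization R A) (w : M), UEnv.ofUnitization R A x • w = x • w)
    (L : Ω[Unitization R A⁄R] →ₗ[Unitization R A] M)
    (hL : ∀ n, 0 < n → ∀ a, L (KaehlerDifferential.D R (Unitization R A)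
        (Unitization.inr (γ R n a)))
      = conv R n a fun j => (UEnv.phiAction M h).φ j
        (L (KaehlerDifferential.D R (Unitization R A) (Unitization.inr a))))
    (u : U0 R) (w : Ω[Unitization R A⁄R]) : L (kaehlerAct R A u w) = UEnv.ofU0 R A u • L w := by
  induction u using U0.induction generalizing w with
  | coeff r => rw [kaehlerAct_coeff, map_smul, UEnv.ofU0_coeff, h]
  | φ p =>
    have : Fact (p : ℕ).Prime := ⟨p.2⟩
    rw [kaehlerAct_φ, map_kaehlerFrob _ L hL, ← pow_one (U0.φ R p), ← U0.phi_prime_pow, pow_one]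
    rfl
  | add u v hu hv =>
    have hadd : kaehlerAct R A (u + v) w = kaehlerAct R A u w + kaehlerAct R A v w := by
      rw [map_add]
      rfl
    rw [hadd, map_add, map_add, add_smul, hu, hv]
  | mul u v hu hv => rw [map_mul, map_mul, mul_smul, ← hv, ← hu]; rfl

theorem mainTheorem5 (R : Type u) [CommRing R] (V : Type v) [AddCommGroup V] [Module R V] :
    ∃ e : Ω[Unitization R (FreeDP R V)⁄R] ≃ₗ[Unitization R (FreeDP R V)]
        (UEnv R (FreeDP R V) ⊗[R] V),
      (∀ x : V,
        e (KaehlerDifferential.D R (Unitization R (FreeDP R V)) (Unitization.inr (FreeDP.ι R V x)))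
          = (1 : UEnv R (FreeDP R V)) ⊗ₜ[R] x) ∧
      (∀ n : ℕ, 0 < n → ∀ a : FreeDP R V,
        e (KaehlerDifferential.D R (Unitization R (FreeDP R V))
            (Unitization.inr (DPAlgebra.γ R n a)))
          = UEnv.ofU0 R (FreeDP R V) (U0.phi R n) •
              e (KaehlerDifferential.D R (Unitization R (FreeDP R V)) (Unitization.inr a))
            + ∑ i ∈ Finset.Ioo 0 n,
                (Unitization.inr (DPAlgebra.γ R i a) : Unitization R (FreeDP R V)) •
                  UEnv.ofU0 R (FreeDP R V) (U0.phi R (n - i)) •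
                    e (KaehlerDifferential.D R (Unitization R (FreeDP R V))
                      (Unitization.inr a))) := by
  let A := FreeDP R V
  let M := UEnv R A ⊗[R] V
  have hM := UEnv.ofUnitization_smul_tensor (R := R) (A := A) (V := V)
  obtain ⟨d, hsmul, hmul, hι, hγ⟩ := FreeDP.exists_derivation (UEnv.phiAction M hM)
    (TensorProduct.mk R (UEnv R A) V 1).toAddMonoidHom (FreeDP.inl_smul_one_tmul R V)
  obtain ⟨L, hL⟩ := exists_kaehler_lift d hsmul hmul
  have hLγ : ∀ n, 0 < n → ∀ a : A, L (KaehlerDifferential.D R (Unitization R A)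
        (Unitization.inr (DPAlgebra.γ R n a)))
      = DPAlgebra.conv R n a fun j => (UEnv.phiAction M hM).φ j
        (L (KaehlerDifferential.D R (Unitization R A) (Unitization.inr a))) := fun n _ a => by
    rw [hL, hL, hγ]
  -- By U(0)-linearity, x u dv is sent to x u (1 ⊗ v) = (x ⊗ u) ⊗ v.
  have hright : ∀ w, L (FreeDP.toKaehler R V w) = w := fun w => by
    induction w using TensorProduct.induction_on with
    | zero => rw [map_zero, map_zero]
    | add w w' h h' => rw [map_add, map_add, h, h']
    | tmul w v =>
      induction w using UEnv.induction with
      | zero => rw [TensorProduct.zero_tmul, map_zero, map_zero]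
      | add w w' h h' => rw [TensorProduct.add_tmul, map_add, map_add, h, h']
      | tmul x u =>
        rw [FreeDP.toKaehler_tmul, map_smul, map_kaehlerAct hM L hLγ, FreeDP.dι_apply, hL, hι, ← hM,
          smul_smul, UEnv.ofUnitization_mul_ofU0]
        change _ • ((1 : UEnv R A) ⊗ₜ[R] v) = _
        rw [TensorProduct.smul_tmul', smul_eq_mul, mul_one]
  -- A surjection with a left inverse is bijective, so the other composite needs no computation.
  have hleft : ∀ w, FreeDP.toKaehler R V (L w) = w := fun w => by
    obtain ⟨z, rfl⟩ := FreeDP.toKaehler_surjective R V w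
    rw [hright]
  refine ⟨LinearEquiv.ofLinearMap L (FreeDP.toKaehler R V) (LinearMap.ext hright)
    (LinearMap.ext hleft), fun x => (hL _).trans (hι x), fun n hn a => ?_⟩
  exact (hLγ n hn a).trans (DPAlgebra.conv_eq_add_sum_Ioo R hn a ((UEnv.phiAction M hM).primitive _).1)
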